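/- **Setting.** Let $a<b$, $n\ge 1$, and for $i=1,\dots,n$ let $\alpha_i,\beta_i:[a,b]^2\to(i-1,i)$ be continuous and $\gamma_1^i,\gamma_2^i\in\mathbb R$. For a variable order $\nu(\cdot,\cdot)>0$ put $$ {}_cI_t^{\nu}y(t)=\int_c^t\frac{(t-\tau)^{\nu(t,\tau)-1}}{\Gamma(\nu(t,\tau))}\,y(\tau)\,d\tau,\qquad {}_tI_d^{\nu}y(t)=\int_t^d\frac{(\tau-t)^{\nu(\tau,t)-1}}{\Gamma(\nu(\tau,t))}\,y(\tau)\,d\tau ,$$ and, for an order $\alpha$ with values in $(i-1,i)$, define the Riemann–Liouville derivatives ${}_cD_t^{\alpha}y=\frac{d^i}{dt^i}\,{}_cI_t^{i-\alpha}y$, ${}_tD_d^{\alpha}y=(-1)^i\frac{d^i}{dt^i}\,{}_tI_d^{i-\alpha}y$ and, for $x\in C^i([a,b])$, the Caputo derivatives ${}^C_aD_t^{\alpha}x={}_aI_t^{i-\alpha}x^{(i)}$, ${}^C_tD_b^{\alpha}x=(-1)^i\,{}_tI_b^{i-\alpha}x^{(i)}$. Derivatives of ${}_cI_t$, $t\ge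 c$, and of ${}_tI_d$, $t\le d$, are taken on the interval on which the integral is considered, namely $[a,b]$ for ${}_aI_t$, $[a,T]$ for ${}_tI_T$ and $[T,b]$ for ${}_TI_t$; they are one-sided at its end points. The combined Caputo derivative is ${}^CD_{\gamma^i}^{\alpha_i,\beta_i}x=\gamma_1^i\,{}^C_aD_t^{\alpha_i}x+\gamma_2^i\,{}^C_tD_b^{\beta_i}x$. Let $L:[a,b]\times\mathbb R^{n+1}\to\mathbb R$ and $\phi:[a,b]\times\mathbb R\to\mathbb R$ be of class $C^1$, write $[x](t)=\big(t,x(t),{}^CD_{\gamma^1}^{\alpha_1,\beta_1}x(t),\dots,{}^CD_{\gamma^n}^{\alpha_n,\beta_n}x(t)\big)$, and consider $$\mathcal J(x,T)=\int_a^T L[x](t)\,dt+\phi(T,x(T))$$ on the set $D$ of pairs $(x,T)\in C^n([a,b])\times[a,b]$ for which all ${}^CD_{\gamma^i}^{\alpha_i,\beta_i}x$ are continuous on $[a,b]$, with the norm $\|(x,T)\|=\max_{t}|x(t)|+\max_t\sum_i|{}^CD_{\gamma^i}^{\alpha_i,\beta_i}x(t)|+|T|$, subject to $x^{(i)}(a)=x_a^i$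 $(i=0,\dots,n-1)$ with given $x_a^i\in\mathbb R$; $T$ and $x(T)$ are free. **Theorem.** Let $(x,T)$ with $a<T<b$ be a local minimizer (for instance a global minimizer) of $\mathcal J$ on $D$ under these constraints, and put $y_i(t)=\partial_{i+2}L[x](t)$. Then the following hold; apart from condition 3, each equation is asserted whenever the fractional derivatives, and the derivatives of fractional integrals, that occur in it with a nonzero coefficient $\gamma_1^i$ or $\gamma_2^i$ exist at the point in question. 1. For $t\in[a,T]$: $\displaystyle \partial_2L[x](t)+\sum_{i=1}^n\Big(\gamma_2^i\,{}_aD_t^{\beta_i}y_i(t)+\gamma_1^i\,{}_tD_T^{\alpha_i}y_i(t)\Big)=0.$ 2. For $t\in[T,b]$: $\displaystyle \sum_{i=1}^n\gamma_2^i\Big({}_aD_t^{\beta_i}y_i(t)-{}_TD_t^{\beta_i}y_i(t)\Big)=0.$ 3. $L[x](T)+\partial_1\phi(T,x(T))+\partial_2\phi(T,x(T))\,x'(T)=0.$ 4. $\displaystyle \sum_{i=1}^n\Big[\gamma_1^i(-1)^{i-1}\frac{d^{i-1}}{dt^{i-1}}\,{}_tI_T^{i-\alpha_i}y_i(t)-\gamma_2^i\frac{d^{i-1}}{dt^{i-1}}\,{}_TI_t^{i-\beta_i}y_i(t)\Big]_{t=T}+\partial_2\phi(T,x(T))=0.$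 5. For $j=1,\dots,n-1$: $\displaystyle \sum_{i=j+1}^n\Big[\gamma_1^i(-1)^{i-1-j}\frac{d^{i-1-j}}{dt^{i-1-j}}\,{}_tI_T^{i-\alpha_i}y_i(t)+\gamma_2^i(-1)^{j+1}\frac{d^{i-1-j}}{dt^{i-1-j}}\,{}_TI_t^{i-\beta_i}y_i(t)\Big]_{t=T}=0.$ 6. For $j=0,\dots,n-1$: $\displaystyle \sum_{i=j+1}^n\gamma_2^i(-1)^{j+1}\Big[\frac{d^{i-1-j}}{dt^{i-1-j}}\,{}_aI_t^{i-\beta_i}y_i(t)-\frac{d^{i-1-j}}{dt^{i-1-j}}\,{}_TI_t^{i-\beta_i}y_i(t)\Big]_{t=b}=0.$ In 4 (with $j=0$) and 5 it is also required, for each $i>j$ with $\gamma_2^i\ne0$, that $\frac{d^{i-1-j}}{dt^{i-1-j}}\,{}_aI_t^{i-\beta_i}y_i$ exists at $t=T$. -/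

import Mathlib

open Set Filter Topology

noncomputable section

namespace FracVar

/-- Left Riemann-Liouville fractional integral with lower terminal `c` and variable order `ν`:
`(1/Γ(ν(t,τ))) (t-τ)^(ν(t,τ)-1) y(τ)` is integrated over `τ` from `c` to `t`. -/
def leftInt (ν : ℝ → ℝ → ℝ) (c : ℝ) (y : ℝ → ℝ) (t : ℝ) : ℝ :=
  ∫ τ in c..t, 1 / Real.Gamma (ν t τ) * (t - τ) ^ (ν t τ - 1) * y τ

/-- Right Riemann-Liouville fractional integral with upper terminal `d` and variable order `ν`:
`(1/Γ(ν(τ,t))) (τ-t)^(ν(τ,t)-1) y(τ)` is integrated over `τ` from `t` to `d`. -/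
def rightInt (ν : ℝ → ℝ → ℝ) (d : ℝ) (y : ℝ → ℝ) (t : ℝ) : ℝ :=
  ∫ τ in t..d, 1 / Real.Gamma (ν τ t) * (τ - t) ^ (ν τ t - 1) * y τ

/-- The complementary order `m - α(·,·)`. -/
def compl (m : ℕ) (α : ℝ → ℝ → ℝ) : ℝ → ℝ → ℝ := fun t τ => (m : ℝ) - α t τ

/-- `f`, as a function on the set `I`, is `k` times differentiable at `t` (one-sidedly at an
end point of `I`): the derivatives of order below `k` exist near `t`, and that of order `k`
exists at `t`. -/
def TimesDiffAt (k : ℕ) (f : ℝ → ℝ) (I : Set ℝ) (t : ℝ) : Prop :=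
  ∀ l < k, DifferentiableWithinAt ℝ (iteratedDerivWithin l f I) I t ∧
    (l + 1 < k → ∀ᶠ s in 𝓝[I] t, DifferentiableWithinAt ℝ (iteratedDerivWithin l f I) I s)

/-- `d^k/dt^k` of the left fractional integral of order `m - α`, on `[c,d]` with lower
terminal `c`. -/
def leftIntDeriv (k m : ℕ) (α : ℝ → ℝ → ℝ) (c d : ℝ) (y : ℝ → ℝ) (t : ℝ) : ℝ :=
  iteratedDerivWithin k (leftInt (compl m α) c y) (Icc c d) t

/-- `d^k/dt^k` of the right fractional integral of order `m - α`, on `[c,d]` with upper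
terminal `d`. -/
def rightIntDeriv (k m : ℕ) (α : ℝ → ℝ → ℝ) (c d : ℝ) (y : ℝ → ℝ) (t : ℝ) : ℝ :=
  iteratedDerivWithin k (rightInt (compl m α) d y) (Icc c d) t

/-- The derivative in `leftIntDeriv` exists at `t`. -/
def LeftIntDerivExists (k m : ℕ) (α : ℝ → ℝ → ℝ) (c d : ℝ) (y : ℝ → ℝ) (t : ℝ) : Prop :=
  TimesDiffAt k (leftInt (compl m α) c y) (Icc c d) t

/-- The derivative in `rightIntDeriv` exists at `t`. -/
def RightIntDerivExists (k m : ℕ) (α : ℝ → ℝ → ℝ) (c d : ℝ) (y : ℝ → ℝ) (t : ℝ) : Prop :=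
  TimesDiffAt k (rightInt (compl m α) d y) (Icc c d) t

/-- Left Riemann-Liouville derivative of order `α`, with values in `(m-1,m)`, on `[c,d]`. -/
def leftRL (m : ℕ) (α : ℝ → ℝ → ℝ) (c d : ℝ) (y : ℝ → ℝ) (t : ℝ) : ℝ :=
  leftIntDeriv m m α c d y t

/-- Right Riemann-Liouville derivative of order `α`, with values in `(m-1,m)`, on `[c,d]`. -/
def rightRL (m : ℕ) (α : ℝ → ℝ → ℝ) (c d : ℝ) (y : ℝ → ℝ) (t : ℝ) : ℝ :=
  (-1) ^ m * rightIntDeriv m m α c d y t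

/-- The left Riemann-Liouville derivative exists at `t`. -/
def LeftRLExists (m : ℕ) (α : ℝ → ℝ → ℝ) (c d : ℝ) (y : ℝ → ℝ) (t : ℝ) : Prop :=
  LeftIntDerivExists m m α c d y t

/-- The right Riemann-Liouville derivative exists at `t`. -/
def RightRLExists (m : ℕ) (α : ℝ → ℝ → ℝ) (c d : ℝ) (y : ℝ → ℝ) (t : ℝ) : Prop :=
  RightIntDerivExists m m α c d y t

/-- Left Caputo derivative of order `α`, with values in `(m-1,m)`, on `[a,b]`. -/
def leftCaputo (m : ℕ) (α : ℝ → ℝ → ℝ) (a b : ℝ) (x : ℝ → ℝ) (t : ℝ) : ℝ :=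
  leftInt (compl m α) a (iteratedDerivWithin m x (Icc a b)) t

/-- Right Caputo derivative of order `β`, with values in `(m-1,m)`, on `[a,b]`. -/
def rightCaputo (m : ℕ) (β : ℝ → ℝ → ℝ) (a b : ℝ) (x : ℝ → ℝ) (t : ℝ) : ℝ :=
  (-1) ^ m * rightInt (compl m β) b (iteratedDerivWithin m x (Icc a b)) t

/-- Combined Caputo derivatives on `[a,b]`. The index `i : Fin n` stands for the derivative whose
orders have values in `(i, i+1)`. -/
def combinedCaputo {n : ℕ} (α β : Fin n → ℝ → ℝ → ℝ) (γ₁ γ₂ : Fin n → ℝ) (a b : ℝ)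
    (i : Fin n) (x : ℝ → ℝ) (t : ℝ) : ℝ :=
  γ₁ i * leftCaputo (i + 1) (α i) a b x t + γ₂ i * rightCaputo (i + 1) (β i) a b x t

/-- Admissible families of variable orders: `α i` is continuous from `[a,b]²` to `(i, i+1)`. -/
def IsOrderFamily {n : ℕ} (α : Fin n → ℝ → ℝ → ℝ) (a b : ℝ) : Prop :=
  ∀ i, ContinuousOn (Function.uncurry (α i)) (Icc a b ×ˢ Icc a b) ∧
    ∀ t ∈ Icc a b, ∀ τ ∈ Icc a b, α i t τ ∈ Ioo (i : ℝ) (i + 1)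

/-- The domain `D`: pairs `(x,T)` with `x` of class `C^n` on `[a,b]`, with continuous combined
Caputo derivatives, and with `T ∈ [a,b]`. -/
def Dom {n : ℕ} (α β : Fin n → ℝ → ℝ → ℝ) (γ₁ γ₂ : Fin n → ℝ) (a b : ℝ) :
    Set ((ℝ → ℝ) × ℝ) :=
  {p | ContDiffOn ℝ n p.1 (Icc a b) ∧
    (∀ i, ContinuousOn (combinedCaputo α β γ₁ γ₂ a b i p.1) (Icc a b)) ∧ p.2 ∈ Icc a b}

/-- The elements of `D` with prescribed derivatives of order `0, …, n-1` at `a`. -/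
def Adm {n : ℕ} (α β : Fin n → ℝ → ℝ → ℝ) (γ₁ γ₂ : Fin n → ℝ) (a b : ℝ) (xa : Fin n → ℝ) :
    Set ((ℝ → ℝ) × ℝ) :=
  {p ∈ Dom α β γ₁ γ₂ a b | ∀ i : Fin n, iteratedDerivWithin i p.1 (Icc a b) a = xa i}

/-- `max |x(t)| + max ∑ |combined Caputo derivatives of x at t| + |T|`, the maxima being
over `t ∈ [a,b]`. -/
def normD {n : ℕ} (α β : Fin n → ℝ → ℝ → ℝ) (γ₁ γ₂ : Fin n → ℝ) (a b : ℝ)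
    (p : (ℝ → ℝ) × ℝ) : ℝ :=
  sSup ((fun t => |p.1 t|) '' Icc a b) +
    sSup ((fun t => ∑ i, |combinedCaputo α β γ₁ γ₂ a b i p.1 t|) '' Icc a b) + |p.2|

/-- The tuple `[x](t)` of arguments of the Lagrangian. -/
def args {n : ℕ} (α β : Fin n → ℝ → ℝ → ℝ) (γ₁ γ₂ : Fin n → ℝ) (a b : ℝ)
    (x : ℝ → ℝ) (t : ℝ) : ℝ × ℝ × (Fin n → ℝ) :=
  (t, x t, fun i => combinedCaputo α β γ₁ γ₂ a b i x t)

/-- The functional `J(x,T)`. -/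
def cost {n : ℕ} (α β : Fin n → ℝ → ℝ → ℝ) (γ₁ γ₂ : Fin n → ℝ) (a b : ℝ)
    (L : ℝ × ℝ × (Fin n → ℝ) → ℝ) (φ : ℝ × ℝ → ℝ) (p : (ℝ → ℝ) × ℝ) : ℝ :=
  (∫ t in a..p.2, L (args α β γ₁ γ₂ a b p.1 t)) + φ (p.2, p.1 p.2)

/-- `p` is a local minimizer of the functional among the admissible pairs, for the norm of `D`. A
global minimizer is one. -/
def IsLocalMinimizer {n : ℕ} (α β : Fin n → ℝ → ℝ → ℝ) (γ₁ γ₂ : Fin n → ℝ) (a b : ℝ)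
    (L : ℝ × ℝ × (Fin n → ℝ) → ℝ) (φ : ℝ × ℝ → ℝ) (xa : Fin n → ℝ)
    (p : (ℝ → ℝ) × ℝ) : Prop :=
  p ∈ Adm α β γ₁ γ₂ a b xa ∧ ∃ δ > 0, ∀ q ∈ Adm α β γ₁ γ₂ a b xa,
    normD α β γ₁ γ₂ a b (q - p) < δ →
      cost α β γ₁ γ₂ a b L φ p ≤ cost α β γ₁ γ₂ a b L φ q

/-- Partial derivative of the Lagrangian with respect to its second argument, the state. -/
def partialState {n : ℕ} (L : ℝ × ℝ × (Fin n → ℝ) → ℝ) (p : ℝ × ℝ × (Fin n → ℝ)) : ℝ :=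
  deriv (fun u => L (p.1, u, p.2.2)) p.2.1

/-- Partial derivative of the Lagrangian with respect to the place of the combined Caputo
derivative with index `i`. -/
def partialVel {n : ℕ} (L : ℝ × ℝ × (Fin n → ℝ) → ℝ) (i : Fin n)
    (p : ℝ × ℝ × (Fin n → ℝ)) : ℝ :=
  deriv (fun v => L (p.1, p.2.1, Function.update p.2.2 i v)) (p.2.2 i)

end FracVar

end

/-!
A minimizer makes the first variation vanish in every direction `h` whose derivatives of order
below `n` vanish at `a`. Fractional integration by parts, which is Fubini's theorem for the weakly
singular kernel over a triangle (`IsWeaklySingular.integral_swap`), turns the first variation into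
`∑ i, (-1)^(i+1) ∫_a^b h^(i+1) F_i + κ h(T) = 0`, where `κ = ∂₂φ(T, x(T))`
(`integral_first_variation`). The functions `F_i` (`costate`) combine the fractional integrals of
the partial derivatives `y_i`, cut off after the time `T`; `F_0` also contains a primitive of `∂₂L`.
On `[a,T]` they carry the terms of the first equation, on `[T,b]` those of the second, and they are
continuous on all of `[a,b]`.

The directions are the `n`-fold primitives from `a` of arbitrary continuous functions. Further
integrations by parts, with primitives vanishing at `b`, and the fundamental lemma of the calculus
of variations give the Euler-Lagrange equations in integrated form (`primSum_eqOn`): the sum of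
the `(n-1-i)`-fold primitives of the `F_i` equals `κ (t-T)^(n-1)/(n-1)!` on `[a,T]` and `0` on
`[T,b]`.

All equations follow by differentiating these two identities at one point. The derivative of order
`n` gives the Euler-Lagrange equations, where the polynomial disappears. The derivative of order
`n-1-j` gives the transversality conditions: at `b`, where the remaining primitives vanish, and at
`T`, where those seen from the left and from the right cancel. Since the existence of a derivative
is assumed at that point only, the differentiation uses the pointwise notion `HasNthDeriv`, which
is additive, unique, and raised by one when passing to a primitive.

The condition for the terminal time is the derivative of the functional with respect to `T` alone.
-/

namespace FracVar

open MeasureTheory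

/-! ### Pointwise derivatives of higher order -/

/-- `HasNthDeriv k f I t v`: on the set `I`, the function `f` is `k` times differentiable at `t`
and its derivative of order `k` there is `v`. As in `TimesDiffAt`, the derivatives of order below
`k` exist near `t`, that of order `k` is required at `t` alone. -/
def HasNthDeriv : ℕ → (ℝ → ℝ) → Set ℝ → ℝ → ℝ → Prop
  | 0, f, _, t, v => f t = v
  | k + 1, f, I, t, v => ∃ f' : ℝ → ℝ, HasDerivWithinAt f (f' t) I t ∧
      (0 < k → ∀ᶠ s in 𝓝[I] t, HasDerivWithinAt f (f' s) I s) ∧ HasNthDeriv k f' I t v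

namespace HasNthDeriv

variable {k : ℕ} {f g : ℝ → ℝ} {I J : Set ℝ} {t v w : ℝ}

theorem mono (h : HasNthDeriv k f I t v) (hJ : J ⊆ I) : HasNthDeriv k f J t v := by
  induction k generalizing f with
  | zero => exact h
  | succ k ih =>
    obtain ⟨f', h1, h2, h3⟩ := h
    exact ⟨f', h1.mono hJ, fun hk => ((h2 hk).filter_mono (nhdsWithin_mono t hJ)).mono
      fun s hs => hs.mono hJ, ih h3⟩

theorem add (hf : HasNthDeriv k f I t v) (hg : HasNthDeriv k g I t w) :
    HasNthDeriv k (f + g) I t (v + w) := by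
  induction k generalizing f g with
  | zero => simp_all [HasNthDeriv]
  | succ k ih =>
    obtain ⟨f', h1, h2, h3⟩ := hf
    obtain ⟨g', l1, l2, l3⟩ := hg
    exact ⟨f' + g', h1.add l1, fun hk => ((h2 hk).and (l2 hk)).mono
      fun s hs => hs.1.add hs.2, ih h3 l3⟩

theorem const_mul (c : ℝ) (hf : HasNthDeriv k f I t v) :
    HasNthDeriv k (fun s => c * f s) I t (c * v) := by
  induction k generalizing f with
  | zero => simp_all [HasNthDeriv]
  | succ k ih =>
    obtain ⟨f', h1, h2, h3⟩ := hf
    exact ⟨fun s => c * f' s, h1.const_mul c, fun hk => (h2 hk).mono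
      fun s hs => hs.const_mul c, ih h3⟩

theorem neg (hf : HasNthDeriv k f I t v) : HasNthDeriv k (fun s => -f s) I t (-v) := by
  simpa using hf.const_mul (-1)

theorem zero : HasNthDeriv k 0 I t 0 := by
  induction k with
  | zero => simp [HasNthDeriv]
  | succ k ih =>
    exact ⟨0, hasDerivWithinAt_const t I (0 : ℝ),
      fun _ => Eventually.of_forall fun s => hasDerivWithinAt_const s I (0 : ℝ), ih⟩

/-- With the coefficient `0` no differentiability is needed. -/
theorem const_mul_of_ne {c : ℝ} (hf : c ≠ 0 → HasNthDeriv k f I t v) :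
    HasNthDeriv k (fun s => c * f s) I t (c * v) := by
  rcases eq_or_ne c 0 with rfl | hc
  · simp only [zero_mul]
    exact zero
  · exact (hf hc).const_mul c

theorem sum {ι : Type*} (s : Finset ι) {F : ι → ℝ → ℝ} {V : ι → ℝ}
    (h : ∀ i ∈ s, HasNthDeriv k (F i) I t (V i)) :
    HasNthDeriv k (∑ i ∈ s, F i) I t (∑ i ∈ s, V i) := by
  classical
  induction s using Finset.induction_on with
  | empty => simpa using zero
  | insert i s hi ih =>
    rw [Finset.sum_insert hi, Finset.sum_insert hi]
    exact (h i (Finset.mem_insert_self i s)).add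
      (ih fun j hj => h j (Finset.mem_insert_of_mem hj))

theorem congr_of_eventuallyEq (hf : HasNthDeriv k f I t v) (hfg : g =ᶠ[𝓝[I] t] f)
    (ht : t ∈ I) : HasNthDeriv k g I t v := by
  cases k with
  | zero => exact (hfg.eq_of_nhdsWithin ht).trans hf
  | succ k =>
    obtain ⟨f', h1, h2, h3⟩ := hf
    refine ⟨f', h1.congr_of_eventuallyEq hfg (hfg.eq_of_nhdsWithin ht), fun hk => ?_, h3⟩
    filter_upwards [h2 hk, eventually_eventually_nhdsWithin.2 hfg, self_mem_nhdsWithin]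
      with s hs hs' hsI
    exact hs.congr_of_eventuallyEq hs' (EventuallyEq.eq_of_nhdsWithin hs' hsI)

theorem congr (hf : HasNthDeriv k f I t v) (hfg : EqOn g f I) (ht : t ∈ I) :
    HasNthDeriv k g I t v :=
  hf.congr_of_eventuallyEq (eventually_of_mem self_mem_nhdsWithin hfg) ht

theorem unique (hf : HasNthDeriv k f I t v) (hg : HasNthDeriv k f I t w) (ht : t ∈ I)
    (hI : UniqueDiffOn ℝ I) : v = w := by
  induction k generalizing f with
  | zero => exact hf.symm.trans hg
  | succ k ih =>
    obtain ⟨f', h1, h2, h3⟩ := hf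
    obtain ⟨g', l1, l2, l3⟩ := hg
    cases k with
    | zero =>
      simp only [HasNthDeriv] at h3 l3
      rw [← h3, ← l3]
      exact (hI t ht).eq_deriv I h1 l1
    | succ k =>
      refine ih (f := f') h3 (l3.congr_of_eventuallyEq ?_ ht)
      filter_upwards [h2 k.succ_pos, l2 k.succ_pos, self_mem_nhdsWithin] with s hs hs' hsI
      exact (hI s hsI).eq_deriv I hs hs'

/-- A primitive of a `k` times differentiable function is `k + 1` times differentiable. -/
theorem primitive (hf : HasNthDeriv k f I t v) (ht : t ∈ I)
    (hg : ∀ s ∈ I, HasDerivWithinAt g (f s) I s) : HasNthDeriv (k + 1) g I t v :=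
  ⟨f, hg t ht, fun _ => eventually_of_mem self_mem_nhdsWithin hg, hf⟩

end HasNthDeriv

theorem TimesDiffAt.hasNthDeriv {k : ℕ} {f : ℝ → ℝ} {I : Set ℝ} {t : ℝ}
    (h : TimesDiffAt k f I t) : HasNthDeriv k f I t (iteratedDerivWithin k f I t) := by
  suffices H : ∀ m l, l + m = k →
      HasNthDeriv m (iteratedDerivWithin l f I) I t (iteratedDerivWithin k f I t) by
    simpa using H k 0 (zero_add k)
  intro m
  induction m with
  | zero => rintro l rfl; rfl
  | succ m ih =>
    intro l hl
    have hd : ∀ s, DifferentiableWithinAt ℝ (iteratedDerivWithin l f I) I s →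
        HasDerivWithinAt (iteratedDerivWithin l f I) (iteratedDerivWithin (l + 1) f I s) I s := by
      intro s hs
      rw [iteratedDerivWithin_succ]
      exact hs.hasDerivWithinAt
    exact ⟨iteratedDerivWithin (l + 1) f I, hd t (h l (by omega)).1,
      fun hm => ((h l (by omega)).2 (by omega)).mono hd, ih (l + 1) (by omega)⟩

/-! ### Iterated primitives -/

/-- The primitive of `f` that vanishes at `c`. -/
noncomputable def prim (c : ℝ) (f : ℝ → ℝ) (t : ℝ) : ℝ := ∫ s in c..t, f s

section Primitives

variable {a b c d p : ℝ} {f g : ℝ → ℝ}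

/-- If an integrable function is continuous on `[c,d]`, its primitives have one-sided derivatives up
to the end points of `[c,d]`. -/
theorem hasDerivWithinAt_prim (hcd : Icc c d ⊆ Icc a b) (hp : p ∈ Icc a b)
    (hf : IntervalIntegrable f volume a b) (hfc : ContinuousOn f (Icc c d))
    {t : ℝ} (ht : t ∈ Icc c d) :
    HasDerivWithinAt (prim p f) (f t) (Icc c d) t := by
  have hab : a ≤ b := hp.1.trans hp.2
  have hint : ∀ u ∈ Icc a b, ∀ v ∈ Icc a b, IntervalIntegrable f volume u v := by
    intro u hu v hv
    refine hf.mono_set ?_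
    rw [uIcc_of_le hab]
    exact ordConnected_Icc.uIcc_subset hu hv
  have hc : c ∈ Icc a b := hcd (left_mem_Icc.2 (ht.1.trans ht.2))
  have hkey : HasDerivWithinAt (fun u => ∫ s in c..u, f s) (f t) (Icc c d) t := by
    have : Fact (t ∈ Icc c d) := ⟨ht⟩
    exact intervalIntegral.integral_hasDerivWithinAt_right (hint _ hc _ (hcd ht))
      (hfc.stronglyMeasurableAtFilter_nhdsWithin measurableSet_Icc t) (hfc t ht)
  have heq : ∀ u ∈ Icc c d, prim p f u = (∫ s in p..c, f s) + ∫ s in c..u, f s := fun u hu =>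
    (intervalIntegral.integral_add_adjacent_intervals (hint _ hp _ hc) (hint _ hc _ (hcd hu))).symm
  exact (hkey.const_add _).congr heq (heq t ht)

theorem continuousOn_prim (hp : p ∈ Icc a b) (hf : IntervalIntegrable f volume a b) :
    ContinuousOn (prim p f) (Icc a b) := by
  have hab : a ≤ b := hp.1.trans hp.2
  rw [← uIcc_of_le hab]
  refine intervalIntegral.continuousOn_primitive_interval' hf ?_
  rwa [uIcc_of_le hab]

theorem intervalIntegrable_prim_iterate (hp : p ∈ Icc a b)
    (hf : IntervalIntegrable f volume a b) (k : ℕ) :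
    IntervalIntegrable ((prim p)^[k] f) volume a b := by
  cases k with
  | zero => exact hf
  | succ k =>
    induction k generalizing f with
    | zero => exact (continuousOn_prim hp hf).intervalIntegrable_of_Icc (hp.1.trans hp.2)
    | succ k ih =>
      exact ih ((continuousOn_prim hp hf).intervalIntegrable_of_Icc (hp.1.trans hp.2))

theorem continuousOn_prim_iterate (hcd : Icc c d ⊆ Icc a b) (hp : p ∈ Icc a b)
    (hf : IntervalIntegrable f volume a b) (hfc : ContinuousOn f (Icc c d)) (k : ℕ) :
    ContinuousOn ((prim p)^[k] f) (Icc c d) := by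
  cases k with
  | zero => exact hfc
  | succ k =>
    rw [Function.iterate_succ_apply']
    exact (continuousOn_prim hp (intervalIntegrable_prim_iterate hp hf k)).mono hcd

theorem prim_self (c : ℝ) (f : ℝ → ℝ) : prim c f c = 0 := intervalIntegral.integral_same

/-- Differentiating an iterated primitive at least as often as it was integrated. -/
theorem HasNthDeriv.prim_iterate {l : ℕ} {t v : ℝ} (hcd : Icc c d ⊆ Icc a b) (hp : p ∈ Icc a b)
    (hf : IntervalIntegrable f volume a b) (hfc : ContinuousOn f (Icc c d))
    (ht : t ∈ Icc c d) (h : HasNthDeriv l f (Icc c d) t v) (k : ℕ) :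
    HasNthDeriv (l + k) ((prim p)^[k] f) (Icc c d) t v := by
  induction k with
  | zero => exact h
  | succ k ih =>
    rw [Function.iterate_succ_apply']
    exact ih.primitive ht fun s hs => hasDerivWithinAt_prim hcd hp
      (intervalIntegrable_prim_iterate hp hf k) (continuousOn_prim_iterate hcd hp hf hfc k) hs

/-- Differentiating an iterated primitive at most as often as it was integrated. -/
theorem hasNthDeriv_prim_iterate {t : ℝ} (hcd : Icc c d ⊆ Icc a b) (hp : p ∈ Icc a b)
    (hf : IntervalIntegrable f volume a b) (hfc : ContinuousOn f (Icc c d))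
    (ht : t ∈ Icc c d) (m k : ℕ) :
    HasNthDeriv m ((prim p)^[m + k] f) (Icc c d) t ((prim p)^[k] f t) := by
  have := HasNthDeriv.prim_iterate (l := 0) hcd hp (intervalIntegrable_prim_iterate hp hf k)
    (continuousOn_prim_iterate hcd hp hf hfc k) ht rfl m
  rwa [zero_add, ← Function.iterate_add_apply] at this

theorem iteratedDerivWithin_prim_iterate {t : ℝ} (hab : a < b) (hp : p ∈ Icc a b)
    (hf : ContinuousOn f (Icc a b)) (ht : t ∈ Icc a b) (m k : ℕ) :
    iteratedDerivWithin m ((prim p)^[m + k] f) (Icc a b) t = (prim p)^[k] f t := by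
  induction m generalizing k t with
  | zero => simp
  | succ m ih =>
    rw [iteratedDerivWithin_succ]
    have hf' := hf.intervalIntegrable_of_Icc hab.le (μ := volume)
    have hk := continuousOn_prim_iterate Subset.rfl hp hf' hf k
    have h1 : EqOn (iteratedDerivWithin m ((prim p)^[m + 1 + k] f) (Icc a b))
        (prim p ((prim p)^[k] f)) (Icc a b) := by
      intro s hs
      rw [show m + 1 + k = m + (k + 1) by ring, ih hs, Function.iterate_succ_apply']
    rw [derivWithin_congr h1 (h1 ht)]
    exact (hasDerivWithinAt_prim Subset.rfl hp (hk.intervalIntegrable_of_Icc hab.le) hk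
      ht).derivWithin (uniqueDiffOn_Icc hab t ht)

theorem contDiff_prim_iterate (p : ℝ) (hf : Continuous f) (k : ℕ) :
    ContDiff ℝ k ((prim p)^[k] f) := by
  induction k with
  | zero => exact contDiff_zero.2 hf
  | succ k ih =>
    rw [Function.iterate_succ_apply', Nat.cast_succ, contDiff_succ_iff_deriv]
    have hd : ∀ t, HasDerivAt (prim p ((prim p)^[k] f)) ((prim p)^[k] f t) t := fun t =>
      intervalIntegral.integral_hasDerivAt_right (ih.continuous.intervalIntegrable _ _)
        (ih.continuous.stronglyMeasurableAtFilter _ _) ih.continuous.continuousAt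
    refine ⟨fun t => (hd t).differentiableAt, fun h => by simp at h, ?_⟩
    rwa [show deriv (prim p ((prim p)^[k] f)) = (prim p)^[k] f from funext fun t => (hd t).deriv]

end Primitives

/-! ### Integration over a triangle -/

/-- `f` is measurable and bounded on `[a,b]`. -/
structure IsBddMeas (f : ℝ → ℝ) (a b : ℝ) : Prop where
  aesm : AEStronglyMeasurable f (volume.restrict (Icc a b))
  bdd : ∃ M, ∀ t ∈ Icc a b, |f t| ≤ M

theorem _root_.ContinuousOn.isBddMeas {f : ℝ → ℝ} {a b : ℝ} (hf : ContinuousOn f (Icc a b)) :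
    IsBddMeas f a b :=
  ⟨hf.aestronglyMeasurable measurableSet_Icc, isCompact_Icc.exists_bound_of_continuousOn hf⟩

theorem IsBddMeas.indicator {f : ℝ → ℝ} {a b : ℝ} (hf : IsBddMeas f a b) {s : Set ℝ}
    (hs : MeasurableSet s) : IsBddMeas (s.indicator f) a b := by
  refine ⟨hf.aesm.indicator hs, hf.bdd.imp fun M hM t ht => ?_⟩
  refine le_trans ?_ (hM t ht)
  simpa using norm_indicator_le_norm_self f t (s := s)

theorem IsBddMeas.intervalIntegrable {f : ℝ → ℝ} {a b : ℝ} (hf : IsBddMeas f a b) (hab : a ≤ b) :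
    IntervalIntegrable f volume a b := by
  obtain ⟨M, hM⟩ := hf.bdd
  rw [intervalIntegrable_iff_integrableOn_Icc_of_le hab]
  exact Integrable.of_bound hf.aesm M
    ((ae_restrict_iff' measurableSet_Icc).2 (Eventually.of_forall hM))

theorem intervalIntegrable_mul_of_continuousOn {f g : ℝ → ℝ} {a b : ℝ} (hab : a ≤ b)
    (hf : ContinuousOn f (Icc a b)) (hg : ContinuousOn g (Icc a b)) :
    IntervalIntegrable (fun t => f t * g t) volume a b :=
  ContinuousOn.intervalIntegrable_of_Icc hab (hf.mul hg)

theorem intervalIntegral_indicator_Iic {f : ℝ → ℝ} {a b T : ℝ} (haT : a ≤ T) (hTb : T ≤ b) :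
    ∫ t in a..b, (Iic T).indicator f t = ∫ t in a..T, f t := by
  rw [intervalIntegral.integral_of_le (haT.trans hTb), intervalIntegral.integral_of_le haT,
    integral_indicator measurableSet_Iic, Measure.restrict_restrict measurableSet_Iic,
    show Iic T ∩ Ioc a b = Ioc a T by ext; simp; grind]

/-- Kernels `k t τ`, defined for `τ < t` in `[a,b]`, with an integrable singularity on the
diagonal. -/
structure IsWeaklySingular (k : ℝ → ℝ → ℝ) (a b : ℝ) : Prop where
  cont : ContinuousOn (Function.uncurry k) {p | p.1 ∈ Icc a b ∧ p.2 ∈ Icc a b ∧ p.2 < p.1}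
  bound : ∃ δ : ℝ, 0 < δ ∧ ∃ C, ∀ t ∈ Icc a b, ∀ τ ∈ Icc a b, τ < t →
    |k t τ| ≤ C * (t - τ) ^ (δ - 1)

section Triangle

variable {k : ℝ → ℝ → ℝ} {a b : ℝ} {f g : ℝ → ℝ}

theorem IsWeaklySingular.intervalIntegrable (hk : IsWeaklySingular k a b) (hg : IsBddMeas g a b)
    {t : ℝ} (ht : t ∈ Icc a b) : IntervalIntegrable (fun τ => k t τ * g τ) volume a t := by
  obtain ⟨δ, hδ, C, hC⟩ := hk.bound
  obtain ⟨M, hM⟩ := hg.bdd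
  have hb : IntervalIntegrable (fun τ => C * (t - τ) ^ (δ - 1) * M) volume a t := by
    have h := (intervalIntegral.intervalIntegrable_rpow' (a := t - a) (b := t - t)
      (show -1 < δ - 1 by linarith)).comp_sub_left t
    simp only [sub_sub_cancel] at h
    exact (h.const_mul C).mul_const M
  rw [intervalIntegrable_iff_integrableOn_Ioo_of_le ht.1] at hb ⊢
  refine Integrable.mono' hb ?_ ?_
  · refine AEStronglyMeasurable.mul ?_ (hg.aesm.mono_measure (Measure.restrict_mono
      (Ioo_subset_Icc_self.trans (Icc_subset_Icc_right ht.2)) le_rfl))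
    refine ContinuousOn.aestronglyMeasurable ?_ measurableSet_Ioo
    exact hk.cont.comp (f := fun τ => (t, τ)) (by fun_prop) fun τ hτ =>
      ⟨ht, ⟨hτ.1.le, hτ.2.le.trans ht.2⟩, hτ.2⟩
  · refine (ae_restrict_iff' measurableSet_Ioo).2 (Eventually.of_forall fun τ hτ => ?_)
    have hτ' : τ ∈ Icc a b := ⟨hτ.1.le, hτ.2.le.trans ht.2⟩
    rw [Real.norm_eq_abs, abs_mul]
    exact mul_le_mul (hC t ht τ hτ' hτ.2) (hM τ hτ') (abs_nonneg _)
      ((abs_nonneg _).trans (hC t ht τ hτ' hτ.2))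

theorem IsWeaklySingular.integrable_triangle (hk : IsWeaklySingular k a b)
    (hf : IsBddMeas f a b) (hg : IsBddMeas g a b) :
    Integrable ({p : ℝ × ℝ | p.2 < p.1}.indicator fun p => f p.1 * (k p.1 p.2 * g p.2))
      ((volume.restrict (Ioc a b)).prod (volume.restrict (Ioc a b))) := by
  obtain ⟨δ, hδ, C, hC⟩ := hk.bound
  obtain ⟨M, hM⟩ := hf.bdd
  obtain ⟨N, hN⟩ := hg.bdd
  have hms : MeasurableSet {p : ℝ × ℝ | p.2 < p.1} := measurableSet_lt measurable_snd measurable_fst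
  have hS : Integrable ((Ioc 0 (b - a)).indicator fun s : ℝ => s ^ (δ - 1)) := by
    rw [integrable_indicator_iff measurableSet_Ioc]
    exact (intervalIntegral.intervalIntegrable_rpow' (a := 0) (b := b - a)
      (show -1 < δ - 1 by linarith)).1
  have hone : Integrable ((Ioc a b).indicator fun _ : ℝ => (1 : ℝ)) := by
    rw [integrable_indicator_iff measurableSet_Ioc]
    exact integrableOn_const (by simp)
  -- the majorant is the integrand of a convolution of two integrable functions
  have hconv := (hone.convolution_integrand (ContinuousLinearMap.mul ℝ ℝ) hS).const_mul
    (M * (C * N))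
  rw [Measure.prod_restrict]
  refine Integrable.mono' hconv.integrableOn ?_ ?_
  · rw [aestronglyMeasurable_indicator_iff hms]
    have hsub : {p : ℝ × ℝ | p.2 < p.1} ∩ Ioc a b ×ˢ Ioc a b ⊆
        {p | p.1 ∈ Icc a b ∧ p.2 ∈ Icc a b ∧ p.2 < p.1} := fun p hp =>
      ⟨Ioc_subset_Icc_self hp.2.1, Ioc_subset_Icc_self hp.2.2, hp.1⟩
    have hle : (volume : Measure ℝ).restrict (Ioc a b) ≤ volume.restrict (Icc a b) :=
      Measure.restrict_mono Ioc_subset_Icc_self le_rfl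
    have h1 : AEStronglyMeasurable (fun p : ℝ × ℝ => f p.1)
        (((volume.prod volume).restrict (Ioc a b ×ˢ Ioc a b)).restrict {p | p.2 < p.1}) := by
      rw [← Measure.prod_restrict]
      exact (hf.aesm.mono_measure hle).comp_fst.mono_measure Measure.restrict_le_self
    have h2 : AEStronglyMeasurable (fun p : ℝ × ℝ => g p.2)
        (((volume.prod volume).restrict (Ioc a b ×ˢ Ioc a b)).restrict {p | p.2 < p.1}) := by
      rw [← Measure.prod_restrict]
      exact (hg.aesm.mono_measure hle).comp_snd.mono_measure Measure.restrict_le_self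
    refine h1.mul (AEStronglyMeasurable.mul ?_ h2)
    rw [Measure.restrict_restrict hms]
    exact (hk.cont.mono hsub).aestronglyMeasurable
      (hms.inter (measurableSet_Ioc.prod measurableSet_Ioc))
  · refine (ae_restrict_iff' (measurableSet_Ioc.prod measurableSet_Ioc)).2
      (Eventually.of_forall fun p hp => ?_)
    by_cases hlt : p.2 < p.1
    · have h1 := Ioc_subset_Icc_self hp.1
      have h2 := Ioc_subset_Icc_self hp.2
      have hs : p.1 - p.2 ∈ Ioc 0 (b - a) := ⟨by linarith, by linarith [h1.2, h2.1]⟩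
      have hK := hC _ h1 _ h2 hlt
      rw [indicator_of_mem (show p ∈ {p : ℝ × ℝ | p.2 < p.1} from hlt)]
      simp only [ContinuousLinearMap.mul_apply', indicator_of_mem hs, indicator_of_mem hp.2,
        one_mul, Real.norm_eq_abs, abs_mul]
      calc |f p.1| * (|k p.1 p.2| * |g p.2|)
          ≤ M * (C * (p.1 - p.2) ^ (δ - 1) * N) :=
            mul_le_mul (hM _ h1) (mul_le_mul hK (hN _ h2) (abs_nonneg _) ((abs_nonneg _).trans hK))
              (by positivity) ((abs_nonneg _).trans (hM _ h1))
        _ = _ := by ring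
    · rw [indicator_of_notMem (show p ∉ {p : ℝ × ℝ | p.2 < p.1} from hlt), norm_zero]
      have hs : p.1 - p.2 ∉ Ioc 0 (b - a) := fun h => hlt (by linarith [h.1])
      simp [indicator_of_notMem hs]

/-- Exchange of the order of integration over the triangle `a < τ < t ≤ b`. With the kernels of
fractional integrals this is fractional integration by parts, with the kernel `1` it is ordinary
integration by parts. -/
theorem IsWeaklySingular.integral_swap (hk : IsWeaklySingular k a b) (hab : a ≤ b)
    (hf : IsBddMeas f a b) (hg : IsBddMeas g a b) :
    ∫ t in a..b, f t * ∫ τ in a..t, k t τ * g τ = ∫ τ in a..b, g τ * ∫ t in τ..b, k t τ * f t := by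
  have h := integral_integral_swap (f := fun t τ => ({p : ℝ × ℝ | p.2 < p.1}.indicator
    fun p => f p.1 * (k p.1 p.2 * g p.2)) (t, τ)) (hk.integrable_triangle hf hg)
  rw [intervalIntegral.integral_of_le hab, intervalIntegral.integral_of_le hab]
  calc _ = _ := setIntegral_congr_fun measurableSet_Ioc fun t ht => ?_
    _ = _ := h
    _ = _ := setIntegral_congr_fun measurableSet_Ioc fun τ hτ => ?_
  · have : (fun τ => ({p : ℝ × ℝ | p.2 < p.1}.indicator
        fun p => f p.1 * (k p.1 p.2 * g p.2)) (t, τ)) =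
        (Iio t).indicator fun τ => f t * (k t τ * g τ) := by
      ext τ
      simp [indicator_apply]
    simp only [this]
    rw [integral_indicator measurableSet_Iio, Measure.restrict_restrict measurableSet_Iio,
      show Iio t ∩ Ioc a b = Ioo a t by ext τ; simp; grind, integral_const_mul,
      intervalIntegral.integral_of_le ht.1.le, integral_Ioc_eq_integral_Ioo]
  · have : (fun t => ({p : ℝ × ℝ | p.2 < p.1}.indicator
        fun p => f p.1 * (k p.1 p.2 * g p.2)) (t, τ)) =
        (Ioi τ).indicator fun t => g τ * (k t τ * f t) := by
      ext t
      simp only [indicator_apply, mem_ofPred_eq, mem_Ioi]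
      split_ifs <;> ring
    simp only [this]
    rw [integral_indicator measurableSet_Ioi, Measure.restrict_restrict measurableSet_Ioi,
      show Ioi τ ∩ Ioc a b = Ioc τ b by ext t; simp; grind, integral_const_mul,
      intervalIntegral.integral_of_le hτ.2]

theorem isWeaklySingular_one : IsWeaklySingular (fun _ _ => 1) a b :=
  ⟨continuousOn_const, 1, one_pos, 1, by simp⟩

theorem integral_prim_mul (hab : a ≤ b) (hf : IsBddMeas f a b) (hg : IsBddMeas g a b) :
    ∫ t in a..b, prim a g t * f t = -∫ t in a..b, g t * prim b f t := by
  have h := (isWeaklySingular_one (a := a) (b := b)).integral_swap hab hf hg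
  simp only [one_mul] at h
  rw [← intervalIntegral.integral_neg]
  calc _ = ∫ t in a..b, f t * ∫ τ in a..t, g τ := by simp only [prim, mul_comm]
    _ = _ := h
    _ = _ := by simp only [prim, intervalIntegral.integral_symm b, mul_neg]

theorem integral_prim_iterate_mul (hab : a ≤ b) (hf : IsBddMeas f a b) (hg : Continuous g)
    (k : ℕ) :
    ∫ t in a..b, (prim a)^[k] g t * f t = (-1) ^ k * ∫ t in a..b, g t * (prim b)^[k] f t := by
  induction k generalizing f with
  | zero => simp
  | succ k ih =>
    rw [Function.iterate_succ_apply', integral_prim_mul hab hf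
      (contDiff_prim_iterate a hg k).continuous.continuousOn.isBddMeas,
      ih (continuousOn_prim (right_mem_Icc.2 hab) (hf.intervalIntegrable hab)).isBddMeas,
      Function.iterate_succ_apply]
    ring

end Triangle

/-! ### Fractional integrals of variable order -/

/-- The kernel `(t-τ)^(ν(t,τ)-1) / Γ(ν(t,τ))` of the fractional integrals of order `ν`. -/
noncomputable def fracKernel (ν : ℝ → ℝ → ℝ) (t τ : ℝ) : ℝ :=
  1 / Real.Gamma (ν t τ) * (t - τ) ^ (ν t τ - 1)

/-- Continuous variable orders on `[a,b]²` with values in `(0,1)`. -/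
def IsFracOrder (ν : ℝ → ℝ → ℝ) (a b : ℝ) : Prop :=
  ContinuousOn (Function.uncurry ν) (Icc a b ×ˢ Icc a b) ∧
    ∀ t ∈ Icc a b, ∀ τ ∈ Icc a b, ν t τ ∈ Ioo (0 : ℝ) 1

section Order

variable {ν : ℝ → ℝ → ℝ} {a b c d : ℝ} {f g y z : ℝ → ℝ}

theorem IsFracOrder.mono (h : IsFracOrder ν a b) (hcd : Icc c d ⊆ Icc a b) : IsFracOrder ν c d :=
  ⟨h.1.mono (prod_mono hcd hcd), fun t ht τ hτ => h.2 t (hcd ht) τ (hcd hτ)⟩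

theorem IsFracOrder.reflect (h : IsFracOrder ν a b) :
    IsFracOrder (fun t τ => ν (-τ) (-t)) (-b) (-a) := by
  have hm : ∀ t ∈ Icc (-b) (-a), -t ∈ Icc a b := fun t ht =>
    ⟨by linarith [ht.2], by linarith [ht.1]⟩
  refine ⟨?_, fun t ht τ hτ => h.2 _ (hm τ hτ) _ (hm t ht)⟩
  exact h.1.comp (f := fun p : ℝ × ℝ => (-p.2, -p.1)) (by fun_prop)
    fun p hp => ⟨hm _ hp.2, hm _ hp.1⟩

theorem IsOrderFamily.isFracOrder_compl {n : ℕ} {α : Fin n → ℝ → ℝ → ℝ}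
    (h : IsOrderFamily α a b) (i : Fin n) : IsFracOrder (compl (i + 1) (α i)) a b := by
  refine ⟨continuousOn_const.sub (h i).1, fun t ht τ hτ => ?_⟩
  have := (h i).2 t ht τ hτ
  constructor <;> simp only [compl] <;> push_cast <;> linarith [this.1, this.2]

theorem IsFracOrder.continuousOn_inv_Gamma (h : IsFracOrder ν a b) :
    ContinuousOn (fun p : ℝ × ℝ => 1 / Real.Gamma (ν p.1 p.2)) (Icc a b ×ˢ Icc a b) := by
  have hΓ : ContinuousOn Real.Gamma (Ioi 0) := fun s hs =>
    (Real.differentiableAt_Gamma fun m => ne_of_gt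
      (lt_of_le_of_lt (neg_nonpos.2 m.cast_nonneg) hs)).continuousAt.continuousWithinAt
  refine continuousOn_const.div (hΓ.comp h.1 fun p hp => (h.2 _ hp.1 _ hp.2).1) fun p hp => ?_
  exact (Real.Gamma_pos_of_pos (h.2 _ hp.1 _ hp.2).1).ne'

theorem IsFracOrder.exists_bounds (h : IsFracOrder ν a b) (hab : a ≤ b) :
    ∃ δ : ℝ, 0 < δ ∧ ∃ C : ℝ, 0 ≤ C ∧ ∀ t ∈ Icc a b, ∀ τ ∈ Icc a b,
      δ ≤ ν t τ ∧ |1 / Real.Gamma (ν t τ)| ≤ C := by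
  have hK : IsCompact (Icc a b ×ˢ Icc a b) := isCompact_Icc.prod isCompact_Icc
  have hne : (Icc a b ×ˢ Icc a b).Nonempty :=
    ⟨(a, a), left_mem_Icc.2 hab, left_mem_Icc.2 hab⟩
  obtain ⟨p, hp, hmin⟩ := hK.exists_isMinOn hne h.1
  obtain ⟨C, hC⟩ := hK.exists_bound_of_continuousOn h.continuousOn_inv_Gamma
  refine ⟨ν p.1 p.2, (h.2 _ hp.1 _ hp.2).1, C, (norm_nonneg _).trans (hC p hp),
    fun t ht τ hτ => ⟨?_, hC (t, τ) ⟨ht, hτ⟩⟩⟩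
  exact hmin (show (t, τ) ∈ Icc a b ×ˢ Icc a b from ⟨ht, hτ⟩)

theorem IsFracOrder.isWeaklySingular (h : IsFracOrder ν a b) (hab : a ≤ b) :
    IsWeaklySingular (fracKernel ν) a b := by
  obtain ⟨δ, hδ, C, hC0, hC⟩ := h.exists_bounds hab
  refine ⟨?_, δ, hδ, C * (1 + (b - a)), fun t ht τ hτ hlt => ?_⟩
  · have hsub : {p : ℝ × ℝ | p.1 ∈ Icc a b ∧ p.2 ∈ Icc a b ∧ p.2 < p.1} ⊆ Icc a b ×ˢ Icc a b :=
      fun p hp => ⟨hp.1, hp.2.1⟩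
    refine (h.continuousOn_inv_Gamma.mono hsub).mul (ContinuousOn.rpow (by fun_prop)
      ((h.1.mono hsub).sub continuousOn_const) fun p hp => Or.inl ?_)
    exact (sub_pos.2 hp.2.2).ne'
  · have hs : 0 < t - τ := sub_pos.2 hlt
    have hν := h.2 t ht τ hτ
    have h1 : (t - τ) ^ (ν t τ - 1) = (t - τ) ^ (ν t τ - δ) * (t - τ) ^ (δ - 1) := by
      rw [← Real.rpow_add hs]; congr 1; ring
    have h2 : (t - τ) ^ (ν t τ - δ) ≤ 1 + (b - a) := by
      have hδν := (hC t ht τ hτ).1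
      calc (t - τ) ^ (ν t τ - δ) ≤ (1 + (b - a)) ^ (ν t τ - δ) :=
            Real.rpow_le_rpow hs.le (by linarith [ht.2, hτ.1]) (by linarith)
        _ ≤ (1 + (b - a)) ^ (1 : ℝ) :=
            Real.rpow_le_rpow_of_exponent_le (by linarith) (by linarith [hν.2])
        _ = _ := Real.rpow_one _
    rw [fracKernel, abs_mul, h1, abs_of_nonneg (a := (t - τ) ^ (ν t τ - δ) * _) (by positivity),
      mul_assoc]
    exact mul_le_mul (hC t ht τ hτ).2 (mul_le_mul_of_nonneg_right h2 (by positivity))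
      (by positivity) hC0

theorem leftInt_eq (ν : ℝ → ℝ → ℝ) (c : ℝ) (y : ℝ → ℝ) (t : ℝ) :
    leftInt ν c y t = ∫ τ in c..t, fracKernel ν t τ * y τ := rfl

theorem rightInt_eq (ν : ℝ → ℝ → ℝ) (d : ℝ) (y : ℝ → ℝ) (t : ℝ) :
    rightInt ν d y t = ∫ τ in t..d, fracKernel ν τ t * y τ := rfl

/-- The reflection of time turns right fractional integrals into left ones. -/
theorem rightInt_eq_leftInt_reflect (ν : ℝ → ℝ → ℝ) (d : ℝ) (y : ℝ → ℝ) (t : ℝ) :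
    rightInt ν d y t = leftInt (fun t τ => ν (-τ) (-t)) (-d) (fun s => y (-s)) (-t) := by
  have h := intervalIntegral.integral_comp_neg (a := -d) (b := -t)
    fun τ => fracKernel ν τ t * y τ
  rw [neg_neg, neg_neg] at h
  rw [rightInt_eq, leftInt_eq, ← h]
  refine intervalIntegral.integral_congr fun τ _ => ?_
  simp only [fracKernel, neg_neg]
  rw [show -τ - t = -t - τ by ring]

theorem leftInt_congr {t : ℝ} (hct : c ≤ t) (h : EqOn y z (Icc c t)) :
    leftInt ν c y t = leftInt ν c z t := by
  refine intervalIntegral.integral_congr fun τ hτ => ?_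
  rw [uIcc_of_le hct] at hτ
  simp only [h hτ]

theorem rightInt_congr {t : ℝ} (htd : t ≤ d) (h : EqOn y z (Icc t d)) :
    rightInt ν d y t = rightInt ν d z t := by
  refine intervalIntegral.integral_congr fun τ hτ => ?_
  rw [uIcc_of_le htd] at hτ
  simp only [h hτ]

theorem leftInt_add_const_mul (hν : IsFracOrder ν a b) (hy : IsBddMeas y a b)
    (hz : IsBddMeas z a b) (ε : ℝ) {t : ℝ} (ht : t ∈ Icc a b) :
    leftInt ν a (fun s => y s + ε * z s) t = leftInt ν a y t + ε * leftInt ν a z t := by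
  have hk := hν.isWeaklySingular (ht.1.trans ht.2)
  simp only [leftInt_eq]
  rw [← intervalIntegral.integral_const_mul, ← intervalIntegral.integral_add
    (hk.intervalIntegrable hy ht) ((hk.intervalIntegrable hz ht).const_mul ε)]
  exact intervalIntegral.integral_congr fun τ _ => by ring

theorem continuousOn_reflect (hy : ContinuousOn y (Icc a b)) :
    ContinuousOn (fun s => y (-s)) (Icc (-b) (-a)) :=
  hy.comp (f := fun s => -s) (by fun_prop) fun _ hs => ⟨by linarith [hs.2], by linarith [hs.1]⟩

theorem rightInt_add_const_mul (hν : IsFracOrder ν a b) (hy : ContinuousOn y (Icc a b))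
    (hz : ContinuousOn z (Icc a b)) (ε : ℝ) {t : ℝ} (ht : t ∈ Icc a b) :
    rightInt ν b (fun s => y s + ε * z s) t = rightInt ν b y t + ε * rightInt ν b z t := by
  simp only [rightInt_eq_leftInt_reflect]
  exact leftInt_add_const_mul hν.reflect (continuousOn_reflect hy).isBddMeas
    (continuousOn_reflect hz).isBddMeas ε ⟨by linarith [ht.2], by linarith [ht.1]⟩

/-- The substitution `τ = t - (t - a) u` moves a fractional integral to the fixed interval
`[0,1]`. -/
theorem leftInt_eq_integral_unit (hν : IsFracOrder ν a b) {t : ℝ} (ht : t ∈ Icc a b) :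
    leftInt ν a y t = ∫ u in (0 : ℝ)..1, 1 / Real.Gamma (ν t (t - (t - a) * u)) *
      (t - a) ^ ν t (t - (t - a) * u) * u ^ (ν t (t - (t - a) * u) - 1) *
      y (t - (t - a) * u) := by
  have hmem : ∀ u ∈ Ioc (0 : ℝ) 1, t - (t - a) * u ∈ Icc a b := fun u hu =>
    ⟨by nlinarith [hu.1, hu.2, ht.1], by nlinarith [hu.1, hu.2, ht.1, ht.2]⟩
  have h := intervalIntegral.smul_integral_comp_sub_mul (a := 0) (b := 1)
    (fun τ => fracKernel ν t τ * y τ) (t - a) t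
  rw [mul_one, mul_zero, sub_zero, sub_sub_cancel] at h
  rw [leftInt_eq, ← h, smul_eq_mul, ← intervalIntegral.integral_const_mul,
    intervalIntegral.integral_of_le zero_le_one, intervalIntegral.integral_of_le zero_le_one]
  refine setIntegral_congr_fun measurableSet_Ioc fun u hu => ?_
  have hν' := (hν.2 t ht _ (hmem u hu)).1
  simp only [fracKernel, sub_sub_cancel]
  rcases ht.1.eq_or_lt with rfl | hlt
  · simp only [sub_self] at hν' ⊢
    rw [Real.zero_rpow hν'.ne']
    simp
  · have hpos : 0 < t - a := sub_pos.2 hlt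
    rw [Real.mul_rpow hpos.le hu.1.le, Real.rpow_sub_one hpos.ne' (ν t (t - (t - a) * u))]
    field_simp

/-- Fractional integrals of continuous functions are continuous, also at the terminal. -/
theorem continuousOn_leftInt (hν : IsFracOrder ν a b) (hy : ContinuousOn y (Icc a b)) :
    ContinuousOn (leftInt ν a y) (Icc a b) := by
  intro t₀ ht₀
  have hab : a ≤ b := ht₀.1.trans ht₀.2
  obtain ⟨δ, hδ, C, hC0, hC⟩ := hν.exists_bounds hab
  obtain ⟨M, hM⟩ := isCompact_Icc.exists_bound_of_continuousOn hy
  have hmem : ∀ t ∈ Icc a b, ∀ u ∈ Ioc (0 : ℝ) 1, t - (t - a) * u ∈ Icc a b := fun t ht u hu =>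
    ⟨by nlinarith [hu.1, hu.2, ht.1], by nlinarith [hu.1, hu.2, ht.1, ht.2]⟩
  suffices H : ContinuousWithinAt (fun t => ∫ u in (0 : ℝ)..1,
      1 / Real.Gamma (ν t (t - (t - a) * u)) * (t - a) ^ ν t (t - (t - a) * u) *
      u ^ (ν t (t - (t - a) * u) - 1) * y (t - (t - a) * u)) (Icc a b) t₀ from
    H.congr (fun t ht => leftInt_eq_integral_unit hν ht) (leftInt_eq_integral_unit hν ht₀)
  -- joint continuity of the integrand serves both for measurability and for the limit
  have hjoint : ContinuousOn (fun p : ℝ × ℝ => 1 / Real.Gamma (ν p.1 (p.1 - (p.1 - a) * p.2)) *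
      (p.1 - a) ^ ν p.1 (p.1 - (p.1 - a) * p.2) * p.2 ^ (ν p.1 (p.1 - (p.1 - a) * p.2) - 1) *
      y (p.1 - (p.1 - a) * p.2)) (Icc a b ×ˢ Ioc 0 1) := by
    have hmaps : MapsTo (fun p : ℝ × ℝ => (p.1, p.1 - (p.1 - a) * p.2)) (Icc a b ×ˢ Ioc 0 1)
        (Icc a b ×ˢ Icc a b) := fun p hp => ⟨hp.1, hmem _ hp.1 _ hp.2⟩
    have hc : ContinuousOn (fun p : ℝ × ℝ => (p.1, p.1 - (p.1 - a) * p.2)) (Icc a b ×ˢ Ioc 0 1) :=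
      by fun_prop
    have hν1 := hν.1.comp hc hmaps
    refine (((hν.continuousOn_inv_Gamma.comp hc hmaps).mul
      (ContinuousOn.rpow (by fun_prop) hν1 fun p hp => Or.inr ?_)).mul
      (ContinuousOn.rpow (by fun_prop) (hν1.sub continuousOn_const) fun p hp => Or.inl ?_)).mul
      (hy.comp (f := fun p : ℝ × ℝ => p.1 - (p.1 - a) * p.2) (by fun_prop)
        fun p hp => hmem _ hp.1 _ hp.2)
    · exact (hν.2 _ hp.1 _ (hmem _ hp.1 _ hp.2)).1
    · exact hp.2.1.ne'
  have hu01 : uIoc (0 : ℝ) 1 = Ioc 0 1 := uIoc_of_le zero_le_one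
  refine intervalIntegral.continuousWithinAt_of_dominated_interval
    (bound := fun u => C * (1 + (b - a)) * u ^ (δ - 1) * M) ?_ ?_ ?_ ?_
  · filter_upwards [self_mem_nhdsWithin] with t ht
    rw [hu01]
    exact (hjoint.comp (f := fun u => (t, u)) (by fun_prop)
      fun u hu => ⟨ht, hu⟩).aestronglyMeasurable measurableSet_Ioc
  · filter_upwards [self_mem_nhdsWithin] with t ht
    refine Eventually.of_forall fun u hu => ?_
    rw [hu01] at hu
    have hm := hmem t ht u hu
    have hν' := hν.2 t ht _ hm
    have h0 : 0 ≤ t - a := sub_nonneg.2 ht.1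
    have h1 : (t - a) ^ ν t (t - (t - a) * u) ≤ 1 + (b - a) := by
      calc (t - a) ^ ν t (t - (t - a) * u) ≤ (1 + (b - a)) ^ ν t (t - (t - a) * u) :=
            Real.rpow_le_rpow h0 (by linarith [ht.2]) hν'.1.le
        _ ≤ (1 + (b - a)) ^ (1 : ℝ) :=
            Real.rpow_le_rpow_of_exponent_le (by linarith) hν'.2.le
        _ = _ := Real.rpow_one _
    have h2 : u ^ (ν t (t - (t - a) * u) - 1) ≤ u ^ (δ - 1) :=
      Real.rpow_le_rpow_of_exponent_ge hu.1 hu.2 (by linarith [(hC t ht _ hm).1])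
    have hu0 : 0 ≤ u := hu.1.le
    rw [Real.norm_eq_abs, abs_mul, abs_mul, abs_mul,
      abs_of_nonneg (Real.rpow_nonneg h0 _), abs_of_nonneg (Real.rpow_nonneg hu0 _)]
    have hb : 0 ≤ 1 + (b - a) := by linarith
    have h3 := mul_le_mul (hC t ht _ hm).2 h1 (Real.rpow_nonneg h0 _) hC0
    exact mul_le_mul (mul_le_mul h3 h2 (Real.rpow_nonneg hu0 _) (mul_nonneg hC0 hb)) (hM _ hm)
      (abs_nonneg _) (mul_nonneg (mul_nonneg hC0 hb) (Real.rpow_nonneg hu0 _))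
  · exact ((intervalIntegral.intervalIntegrable_rpow' (by linarith)).const_mul _).mul_const _
  · refine Eventually.of_forall fun u hu => ?_
    rw [hu01] at hu
    exact (hjoint.comp (f := fun t => (t, u)) (by fun_prop) fun t ht => ⟨ht, hu⟩) t₀ ht₀

theorem continuousOn_rightInt (hν : IsFracOrder ν a b) (hy : ContinuousOn y (Icc a b)) :
    ContinuousOn (rightInt ν b y) (Icc a b) := by
  have h := continuousOn_leftInt hν.reflect (continuousOn_reflect hy)
  refine (h.comp (f := fun t => -t) (by fun_prop) fun t ht =>
    ⟨by linarith [ht.2], by linarith [ht.1]⟩).congr fun t _ => ?_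
  exact rightInt_eq_leftInt_reflect ν b y t

/-- Fractional integration by parts. -/
theorem integral_mul_leftInt (hν : IsFracOrder ν a b) (hab : a ≤ b) (hf : IsBddMeas f a b)
    (hg : IsBddMeas g a b) :
    ∫ t in a..b, f t * leftInt ν a g t = ∫ t in a..b, g t * rightInt ν b f t :=
  (hν.isWeaklySingular hab).integral_swap hab hf hg

/-! ### Fractional integrals of a function that is cut off after the time `T` -/

variable {T t : ℝ}

theorem leftInt_indicator_of_le (hat : a ≤ t) (htT : t ≤ T) :
    leftInt ν a ((Iic T).indicator y) t = leftInt ν a y t :=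
  leftInt_congr hat fun _ hs => indicator_of_mem (show _ ∈ Iic T from hs.2.trans htT) _

theorem leftInt_indicator_of_ge (hν : IsFracOrder ν a b) (hy : ContinuousOn y (Icc a b))
    (haT : a ≤ T) (hTt : T ≤ t) (htb : t ≤ b) :
    leftInt ν a ((Iic T).indicator y) t = leftInt ν a y t - leftInt ν T y t := by
  have ht : t ∈ Icc a b := ⟨haT.trans hTt, htb⟩
  have hk := hν.isWeaklySingular (ht.1.trans ht.2)
  have hsub : ∀ {z : ℝ → ℝ}, IsBddMeas z a b →
      IntervalIntegrable (fun τ => fracKernel ν t τ * z τ) volume a T ∧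
      IntervalIntegrable (fun τ => fracKernel ν t τ * z τ) volume T t := fun {z} hz => by
    have h := hk.intervalIntegrable hz ht
    constructor <;> refine h.mono_set ?_ <;> rw [uIcc_of_le ht.1, uIcc_of_le (by assumption)]
    · exact Icc_subset_Icc_right hTt
    · exact Icc_subset_Icc_left haT
  have hy' := hsub hy.isBddMeas
  have hc' := hsub (hy.isBddMeas.indicator (measurableSet_Iic (a := T)))
  simp only [leftInt_eq]
  rw [← intervalIntegral.integral_add_adjacent_intervals hc'.1 hc'.2,
    ← intervalIntegral.integral_add_adjacent_intervals hy'.1 hy'.2, add_sub_cancel_right]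
  have h2 : ∫ τ in T..t, fracKernel ν t τ * (Iic T).indicator y τ = 0 := by
    rw [intervalIntegral.integral_of_le hTt]
    refine setIntegral_eq_zero_of_forall_eq_zero fun τ hτ => ?_
    rw [indicator_of_notMem (show τ ∉ Iic T from not_le.2 hτ.1), mul_zero]
  rw [h2, add_zero]
  refine intervalIntegral.integral_congr fun τ hτ => ?_
  rw [uIcc_of_le haT] at hτ
  simp only [indicator_of_mem (show τ ∈ Iic T from hτ.2)]

theorem rightInt_indicator_of_ge (hTt : T ≤ t) (htb : t ≤ b) :
    rightInt ν b ((Iic T).indicator y) t = 0 := by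
  rw [rightInt_eq, intervalIntegral.integral_of_le htb]
  refine setIntegral_eq_zero_of_forall_eq_zero fun τ hτ => ?_
  rw [indicator_of_notMem (show τ ∉ Iic T from not_le.2 (hTt.trans_lt hτ.1)), mul_zero]

theorem rightInt_indicator_of_le (htT : t ≤ T) (hTb : T ≤ b) :
    rightInt ν b ((Iic T).indicator y) t = rightInt ν T y t := by
  have hset : ∀ τ, fracKernel ν τ t * (Iic T).indicator y τ =
      (Iic T).indicator (fun τ => fracKernel ν τ t * y τ) τ := fun τ => by
    simp only [indicator_apply]
    split_ifs <;> simp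
  rw [rightInt_eq, rightInt_eq, ← intervalIntegral_indicator_Iic htT hTb]
  simp only [hset]

theorem continuousOn_leftInt_indicator (hν : IsFracOrder ν a b) (hy : ContinuousOn y (Icc a b))
    (haT : a ≤ T) (hTb : T ≤ b) : ContinuousOn (leftInt ν a ((Iic T).indicator y)) (Icc a b) := by
  have hc := continuousOn_leftInt hν hy
  have hT : Icc T b ⊆ Icc a b := Icc_subset_Icc_left haT
  rw [← Icc_union_Icc_eq_Icc haT hTb]
  refine ContinuousOn.union_of_isClosed ?_ ?_ isClosed_Icc isClosed_Icc
  · exact (hc.mono (Icc_subset_Icc_right hTb)).congr fun t ht =>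
      leftInt_indicator_of_le ht.1 ht.2
  · exact ((hc.mono hT).sub (continuousOn_leftInt (hν.mono hT) (hy.mono hT))).congr fun t ht =>
      leftInt_indicator_of_ge hν hy haT ht.1 ht.2

theorem continuousOn_rightInt_indicator (hν : IsFracOrder ν a b) (hy : ContinuousOn y (Icc a b))
    (haT : a ≤ T) (hTb : T ≤ b) : ContinuousOn (rightInt ν b ((Iic T).indicator y)) (Icc a b) := by
  have hT : Icc a T ⊆ Icc a b := Icc_subset_Icc_right hTb
  rw [← Icc_union_Icc_eq_Icc haT hTb]
  refine ContinuousOn.union_of_isClosed ?_ ?_ isClosed_Icc isClosed_Icc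
  · exact (continuousOn_rightInt (hν.mono hT) (hy.mono hT)).congr fun t ht =>
      rightInt_indicator_of_le ht.2 hTb
  · exact (continuousOn_const (c := (0 : ℝ))).congr fun t ht => rightInt_indicator_of_ge ht.1 ht.2

end Order

/-! ### The integrated necessary conditions -/

section DuBoisReymond

variable {n : ℕ} {a b T : ℝ} {F : Fin n → ℝ → ℝ} {κ : ℝ}

/-- The fundamental lemma of the calculus of variations for bounded functions. -/
theorem IsBddMeas.ae_eq_zero {f : ℝ → ℝ} (hf : IsBddMeas f a b) (hab : a ≤ b)
    (h : ∀ g : ℝ → ℝ, Continuous g → ∫ t in a..b, g t * f t = 0) :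
    ∀ᵐ t, t ∈ Ioo a b → f t = 0 := by
  have hint := (hf.intervalIntegrable hab).1
  refine isOpen_Ioo.ae_eq_zero_of_integral_contDiff_smul_eq_zero
    (hint.mono_set Ioo_subset_Ioc_self).locallyIntegrableOn fun g hg _ hsupp => ?_
  rw [← h g hg.continuous, intervalIntegral.integral_of_le hab]
  refine (setIntegral_eq_integral_of_forall_compl_eq_zero fun t ht => ?_).symm
  have : t ∉ tsupport g := fun h => ht (Ioo_subset_Ioc_self (hsupp h))
  rw [image_eq_zero_of_notMem_tsupport this, zero_smul]

/-- The iterated primitives, vanishing at `b`, of the characteristic function of `(-∞,T]`. -/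
noncomputable def stepPrim (T b : ℝ) (k : ℕ) : ℝ → ℝ := (prim b)^[k] ((Iic T).indicator 1)

theorem isBddMeas_step (T : ℝ) : IsBddMeas ((Iic T).indicator 1) a b :=
  (continuousOn_const (c := (1 : ℝ))).isBddMeas.indicator measurableSet_Iic

theorem stepPrim_eq_zero {k : ℕ} {t : ℝ} (ht : T < t) (htb : t ≤ b) : stepPrim T b k t = 0 := by
  induction k generalizing t with
  | zero => exact indicator_of_notMem (show t ∉ Iic T from not_le.2 ht) _
  | succ k ih =>
    rw [stepPrim, Function.iterate_succ_apply', prim, intervalIntegral.integral_symm,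
      intervalIntegral.integral_of_le htb, neg_eq_zero]
    exact setIntegral_eq_zero_of_forall_eq_zero fun s hs => ih (ht.trans hs.1) hs.2

theorem stepPrim_succ_self (hTb : T ≤ b) (k : ℕ) : stepPrim T b (k + 1) T = 0 := by
  rw [stepPrim, Function.iterate_succ_apply', prim, intervalIntegral.integral_symm,
    intervalIntegral.integral_of_le hTb, neg_eq_zero]
  exact setIntegral_eq_zero_of_forall_eq_zero fun s hs => stepPrim_eq_zero hs.1 hs.2

theorem continuousOn_step (a T : ℝ) : ContinuousOn ((Iic T).indicator (1 : ℝ → ℝ)) (Icc a T) :=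
  (continuousOn_const (c := (1 : ℝ))).congr fun _ ht =>
    indicator_of_mem (show _ ∈ Iic T from ht.2) _

/-- The sum of the `F i`, each integrated so often that `n` derivatives of the sum produce the
derivative of order `i + 1` of `F i`. -/
noncomputable def primSum (b : ℝ) (F : Fin n → ℝ → ℝ) : ℝ → ℝ :=
  ∑ i : Fin n, (prim b)^[n - 1 - i] (F i)

theorem continuousOn_primSum (hab : a ≤ b) (hF : ∀ i, ContinuousOn (F i) (Icc a b)) :
    ContinuousOn (primSum b F) (Icc a b) := by
  have : primSum b F = fun t => ∑ i : Fin n, (prim b)^[n - 1 - i] (F i) t := by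
    ext t; simp [primSum]
  rw [this]
  exact continuousOn_finsetSum _ fun i _ => continuousOn_prim_iterate Subset.rfl
    (right_mem_Icc.2 hab) ((hF i).intervalIntegrable_of_Icc hab) (hF i) _

/-- In `hvar` the direction is `(prim a)^[n] g`: its derivatives of order below `n` vanish at `a`,
and its derivative of order `n` is the arbitrary function `g`. After integration by parts the first
variation has the form `∫ g f`, so that `f = 0` almost everywhere. -/
theorem primSum_ae_eq (hn : 1 ≤ n) (hT : T ∈ Ioo a b) (hF : ∀ i, ContinuousOn (F i) (Icc a b))
    (hvar : ∀ g : ℝ → ℝ, Continuous g → ∑ i : Fin n, (-1) ^ ((i : ℕ) + 1) *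
      (∫ t in a..b, (prim a)^[n - 1 - i] g t * F i t) + κ * (prim a)^[n] g T = 0) :
    ∀ᵐ t, t ∈ Ioo a b → primSum b F t = κ * stepPrim T b (n - 1) t := by
  have hab : a ≤ b := (hT.1.trans hT.2).le
  have hb : b ∈ Icc a b := right_mem_Icc.2 hab
  have hstep : IsBddMeas (stepPrim T b (n - 1)) a b := by
    unfold stepPrim
    cases n - 1 with
    | zero => exact isBddMeas_step T
    | succ k =>
      rw [Function.iterate_succ_apply']
      exact (continuousOn_prim hb (intervalIntegrable_prim_iterate hb
        ((isBddMeas_step T).intervalIntegrable hab) k)).isBddMeas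
  have hQ := continuousOn_primSum hab hF
  have hdiff : IsBddMeas (fun t => primSum b F t - κ * stepPrim T b (n - 1) t) a b := by
    refine ⟨hQ.isBddMeas.aesm.sub (hstep.aesm.const_mul κ), ?_⟩
    obtain ⟨M, hM⟩ := hQ.isBddMeas.bdd
    obtain ⟨N, hN⟩ := hstep.bdd
    refine ⟨M + |κ| * N, fun t ht => (abs_sub _ _).trans (add_le_add (hM t ht) ?_)⟩
    rw [abs_mul]
    exact mul_le_mul_of_nonneg_left (hN t ht) (abs_nonneg _)
  refine (hdiff.ae_eq_zero hab fun g hg => ?_).mono fun t h ht => sub_eq_zero.1 (h ht)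
  have hFi : ∀ i : Fin n, IntervalIntegrable (fun t => g t * (prim b)^[n - 1 - i] (F i) t)
      volume a b := fun i =>
    (hg.continuousOn.mul (continuousOn_prim_iterate Subset.rfl hb
      ((hF i).intervalIntegrable_of_Icc hab) (hF i) _)).intervalIntegrable_of_Icc hab
  have hterm : ∀ i : Fin n, (-1) ^ ((i : ℕ) + 1) *
      (∫ t in a..b, (prim a)^[n - 1 - i] g t * F i t) =
      (-1) ^ n * ∫ t in a..b, g t * (prim b)^[n - 1 - i] (F i) t := fun i => by
    rw [integral_prim_iterate_mul hab (hF i).isBddMeas hg, ← mul_assoc, ← pow_add]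
    congr 2
    omega
  have hend : (prim a)^[n] g T = -((-1) ^ n * ∫ t in a..b, g t * stepPrim T b (n - 1) t) := by
    obtain ⟨m, rfl⟩ : ∃ m, n = m + 1 := ⟨n - 1, by omega⟩
    have h := integral_prim_iterate_mul hab (isBddMeas_step (a := a) (b := b) T) hg m
    rw [Function.iterate_succ_apply', Nat.add_sub_cancel, pow_succ, mul_neg_one, neg_mul, neg_neg,
      stepPrim, ← h, prim, ← intervalIntegral_indicator_Iic hT.1.le hT.2.le]
    have hind : ∀ t, (prim a)^[m] g t * (Iic T).indicator 1 t =
        (Iic T).indicator ((prim a)^[m] g) t := fun t => by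
      simp only [indicator_apply]
      split_ifs <;> simp
    simp only [hind]
  have hv := hvar g hg
  simp only [hterm] at hv
  rw [hend, ← Finset.mul_sum] at hv
  have hsum : ∫ t in a..b, g t * (primSum b F t - κ * stepPrim T b (n - 1) t) =
      (∑ i : Fin n, ∫ t in a..b, g t * (prim b)^[n - 1 - i] (F i) t) -
        κ * ∫ t in a..b, g t * stepPrim T b (n - 1) t := by
    have hgQ : IntervalIntegrable (fun t => g t * primSum b F t) volume a b :=
      (hg.continuousOn.mul hQ).intervalIntegrable_of_Icc hab
    have hgE : IntervalIntegrable (fun t => κ * (g t * stepPrim T b (n - 1) t)) volume a b :=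
      ((hstep.intervalIntegrable hab).continuousOn_mul hg.continuousOn).const_mul κ
    rw [← intervalIntegral.integral_const_mul, ← intervalIntegral.integral_finsetSum
      fun i _ => hFi i]
    calc _ = ∫ t in a..b, (g t * primSum b F t - κ * (g t * stepPrim T b (n - 1) t)) :=
          intervalIntegral.integral_congr fun t _ => by ring
      _ = _ := by
          rw [intervalIntegral.integral_sub hgQ hgE]
          simp only [primSum, Finset.sum_apply, Finset.mul_sum]
  rw [hsum]
  have : (-1 : ℝ) ^ n * ((∑ i : Fin n, ∫ t in a..b, g t * (prim b)^[n - 1 - i] (F i) t) -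
      κ * ∫ t in a..b, g t * stepPrim T b (n - 1) t) = 0 := by linarith
  exact (mul_eq_zero.1 this).resolve_left (pow_ne_zero _ (by norm_num))

/-- The necessary conditions on `[a,T]` and on `[T,b]`, in integrated form. -/
theorem primSum_eqOn (hn : 1 ≤ n) (hT : T ∈ Ioo a b) (hF : ∀ i, ContinuousOn (F i) (Icc a b))
    (hvar : ∀ g : ℝ → ℝ, Continuous g → ∑ i : Fin n, (-1) ^ ((i : ℕ) + 1) *
      (∫ t in a..b, (prim a)^[n - 1 - i] g t * F i t) + κ * (prim a)^[n] g T = 0) :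
    EqOn (primSum b F) (fun t => κ * stepPrim T b (n - 1) t) (Icc a T) ∧
      EqOn (primSum b F) 0 (Icc T b) := by
  have hab : a ≤ b := (hT.1.trans hT.2).le
  have hQ := continuousOn_primSum hab hF
  have hae := primSum_ae_eq hn hT hF hvar
  constructor
  · refine Measure.eqOn_Icc_of_ae_eq volume hT.1.ne ?_ (hQ.mono (Icc_subset_Icc_right hT.2.le))
      (continuousOn_const.mul (continuousOn_prim_iterate (Icc_subset_Icc_right hT.2.le)
        (right_mem_Icc.2 hab) ((isBddMeas_step T).intervalIntegrable hab)
        (continuousOn_step a T) _))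
    rw [Measure.restrict_congr_set Ioo_ae_eq_Icc.symm]
    refine (ae_restrict_iff' measurableSet_Ioo).2 (hae.mono fun t h ht => h ?_)
    exact ⟨ht.1, ht.2.trans hT.2⟩
  · refine Measure.eqOn_Icc_of_ae_eq volume hT.2.ne ?_ (hQ.mono (Icc_subset_Icc_left hT.1.le))
      continuousOn_const
    rw [Measure.restrict_congr_set Ioo_ae_eq_Icc.symm]
    refine (ae_restrict_iff' measurableSet_Ioo).2 (hae.mono fun t h ht => ?_)
    rw [h ⟨hT.1.trans ht.1, ht.2⟩, stepPrim_eq_zero ht.1 ht.2.le]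
    simp

/-! ### Differentiation of the integrated conditions -/

variable {c d t : ℝ} {V V' : Fin n → ℝ}

theorem hasNthDeriv_primSum_top (hab : a ≤ b) (hF : ∀ i, ContinuousOn (F i) (Icc a b))
    (hcd : Icc c d ⊆ Icc a b) (ht : t ∈ Icc c d)
    (hV : ∀ i : Fin n, HasNthDeriv (i + 1) (F i) (Icc c d) t (V i)) :
    HasNthDeriv n (primSum b F) (Icc c d) t (∑ i, V i) := by
  refine HasNthDeriv.sum _ fun i _ => ?_
  have h := (hV i).prim_iterate hcd (right_mem_Icc.2 hab)
    ((hF i).intervalIntegrable_of_Icc hab) ((hF i).mono hcd) ht (n - 1 - i)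
  rwa [show (i : ℕ) + 1 + (n - 1 - i) = n by omega] at h

theorem hasNthDeriv_primSum (hab : a ≤ b) (hF : ∀ i, ContinuousOn (F i) (Icc a b))
    (hcd : Icc c d ⊆ Icc a b) (ht : t ∈ Icc c d) {j : ℕ} (hj : j ≤ n - 1)
    (hV : ∀ i : Fin n, j ≤ i → HasNthDeriv (i - j) (F i) (Icc c d) t (V i)) :
    HasNthDeriv (n - 1 - j) (primSum b F) (Icc c d) t
      (∑ i ∈ Finset.univ.filter (fun i : Fin n => j ≤ (i : ℕ)), V i +
        ∑ i ∈ Finset.univ.filter (fun i : Fin n => ¬ j ≤ (i : ℕ)), (prim b)^[j - i] (F i) t) := by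
  rw [primSum, ← Finset.sum_filter_add_sum_filter_not Finset.univ (fun i : Fin n => j ≤ (i : ℕ))]
  have hi := fun i => (hF i).intervalIntegrable_of_Icc (μ := volume) hab
  refine (HasNthDeriv.sum _ fun i h => ?_).add (HasNthDeriv.sum _ fun i h => ?_)
  · have h' : j ≤ (i : ℕ) := (Finset.mem_filter.1 h).2
    have := (hV i h').prim_iterate hcd (right_mem_Icc.2 hab) (hi i) ((hF i).mono hcd) ht (n - 1 - i)
    rwa [show (i : ℕ) - j + (n - 1 - i) = n - 1 - j by omega] at this
  · have h' : ¬ j ≤ (i : ℕ) := (Finset.mem_filter.1 h).2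
    have := hasNthDeriv_prim_iterate hcd (right_mem_Icc.2 hab) (hi i) ((hF i).mono hcd) ht
      (n - 1 - j) (j - i)
    rwa [show n - 1 - j + (j - i) = n - 1 - (i : ℕ) by omega] at this

theorem hasNthDeriv_stepPrim_top (hT : T ∈ Ioo a b) (hn : 1 ≤ n) (ht : t ∈ Icc a T) :
    HasNthDeriv n (stepPrim T b (n - 1)) (Icc a T) t 0 := by
  have hab : a ≤ b := (hT.1.trans hT.2).le
  have h1 : HasNthDeriv 1 ((Iic T).indicator (1 : ℝ → ℝ)) (Icc a T) t 0 :=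
    (show HasNthDeriv 1 (fun _ => (1 : ℝ)) (Icc a T) t 0 from
      ⟨0, hasDerivWithinAt_const _ _ _, fun h => absurd h (lt_irrefl 0), rfl⟩).congr
      (fun s hs => indicator_of_mem (show s ∈ Iic T from hs.2) _) ht
  have h := h1.prim_iterate (Icc_subset_Icc_right hT.2.le) (right_mem_Icc.2 hab)
    ((isBddMeas_step T).intervalIntegrable hab) (continuousOn_step a T) ht (n - 1)
  rwa [show 1 + (n - 1) = n by omega] at h

theorem hasNthDeriv_stepPrim (hT : T ∈ Ioo a b) (ht : t ∈ Icc a T) {j m : ℕ} (hj : j ≤ m) :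
    HasNthDeriv (m - j) (stepPrim T b m) (Icc a T) t (stepPrim T b j t) := by
  have hab : a ≤ b := (hT.1.trans hT.2).le
  have h := hasNthDeriv_prim_iterate (Icc_subset_Icc_right hT.2.le) (right_mem_Icc.2 hab)
    ((isBddMeas_step T).intervalIntegrable hab) (continuousOn_step a T) ht (m - j) j
  rwa [show m - j + j = m by omega] at h

end DuBoisReymond

/-! ### Differentiation of the functional -/

section Lagrangian

variable {E : Type*} [NormedAddCommGroup E] [NormedSpace ℝ E] {a b T : ℝ}

theorem uniqueDiffOn_strip (hab : a < b) :
    UniqueDiffOn ℝ (Icc a b ×ˢ (univ : Set E)) :=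
  (uniqueDiffOn_Icc hab).prod uniqueDiffOn_univ

theorem hasDerivAt_integral_lagrangian {L : ℝ × E → ℝ} (hab : a < b)
    (hL : ContDiffOn ℝ 1 L (Icc a b ×ˢ univ)) {X H : ℝ → E} (hX : ContinuousOn X (Icc a b))
    (hH : ContinuousOn H (Icc a b)) (hT : T ∈ Icc a b) :
    HasDerivAt (fun ε : ℝ => ∫ t in a..T, L (t, X t + ε • H t))
      (∫ t in a..T, fderivWithin ℝ L (Icc a b ×ˢ univ) (t, X t) (0, H t)) 0 := by
  have hu : uIoc a T = Ioc a T := uIoc_of_le hT.1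
  have hsub : Ioc a T ⊆ Icc a b := Ioc_subset_Icc_self.trans (Icc_subset_Icc_right hT.2)
  have hcurve : ContinuousOn (fun p : ℝ × ℝ => (p.2, X p.2 + p.1 • H p.2)) (univ ×ˢ Icc a b) := by
    have hX' : ContinuousOn (fun p : ℝ × ℝ => X p.2) (univ ×ˢ Icc a b) :=
      hX.comp continuousOn_snd fun p hp => hp.2
    have hH' : ContinuousOn (fun p : ℝ × ℝ => H p.2) (univ ×ˢ Icc a b) :=
      hH.comp continuousOn_snd fun p hp => hp.2
    exact continuousOn_snd.prodMk (hX'.add (continuousOn_fst.smul hH'))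
  have hmaps : MapsTo (fun p : ℝ × ℝ => (p.2, X p.2 + p.1 • H p.2)) (univ ×ˢ Icc a b)
      (Icc a b ×ˢ (univ : Set E)) := fun p hp => ⟨hp.2, mem_univ _⟩
  have hF : ContinuousOn (fun p : ℝ × ℝ => L (p.2, X p.2 + p.1 • H p.2)) (univ ×ˢ Icc a b) :=
    hL.continuousOn.comp hcurve hmaps
  have hF' : ContinuousOn (fun p : ℝ × ℝ => fderivWithin ℝ L (Icc a b ×ˢ univ)
      (p.2, X p.2 + p.1 • H p.2) (0, H p.2)) (univ ×ˢ Icc a b) := by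
    refine ((hL.continuousOn_fderivWithin (uniqueDiffOn_strip hab) le_rfl).comp hcurve
      hmaps).clm_apply (continuousOn_const.prodMk (hH.comp continuousOn_snd fun p hp => hp.2))
  have hslice : ∀ {f : ℝ × ℝ → ℝ}, ContinuousOn f (univ ×ˢ Icc a b) → ∀ ε : ℝ,
      ContinuousOn (fun t => f (ε, t)) (Icc a b) := fun hf ε =>
    hf.comp (f := fun t => (ε, t)) (by fun_prop) fun t ht => ⟨mem_univ _, ht⟩
  obtain ⟨C, hC⟩ := (isCompact_Icc.prod isCompact_Icc).exists_bound_of_continuousOn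
    (hF'.mono (prod_mono_left (subset_univ (Icc (-1 : ℝ) 1))))
  have key := intervalIntegral.hasDerivAt_integral_of_dominated_loc_of_deriv_le (μ := volume)
    (F := fun ε t => L (t, X t + ε • H t))
    (F' := fun ε t => fderivWithin ℝ L (Icc a b ×ˢ univ) (t, X t + ε • H t) (0, H t))
    (x₀ := (0 : ℝ)) (s := Icc (-1) 1) (a := a) (b := T) (bound := fun _ => C)
    (Icc_mem_nhds (by norm_num) (by norm_num)) ?_ ?_ ?_ ?_ ?_ ?_
  · simpa using key.2
  · refine Eventually.of_forall fun ε => ?_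
    rw [hu]
    exact ((hslice hF ε).mono hsub).aestronglyMeasurable measurableSet_Ioc
  · exact ((hslice hF 0).mono (Icc_subset_Icc_right hT.2)).intervalIntegrable_of_Icc hT.1
  · rw [hu]
    exact ((hslice hF' 0).mono hsub).aestronglyMeasurable measurableSet_Ioc
  · refine Eventually.of_forall fun t ht ε hε => ?_
    rw [hu] at ht
    exact hC (ε, t) ⟨hε, hsub ht⟩
  · exact intervalIntegrable_const
  · refine Eventually.of_forall fun t ht ε _ => ?_
    rw [hu] at ht
    have h1 : HasFDerivWithinAt L (fderivWithin ℝ L (Icc a b ×ˢ univ) (t, X t + ε • H t))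
        (Icc a b ×ˢ univ) (t, X t + ε • H t) :=
      (hL.differentiableOn one_ne_zero (t, X t + ε • H t)
        ⟨hsub ht, mem_univ _⟩).hasFDerivWithinAt
    have h2 : HasDerivAt (fun ε : ℝ => (t, X t + ε • H t)) (0, H t) ε := by
      have := ((hasDerivAt_id ε).smul_const (H t)).const_add (X t)
      rw [one_smul] at this
      exact (hasDerivAt_const ε t).prodMk this
    have h3 : MapsTo (fun ε : ℝ => (t, X t + ε • H t)) univ (Icc a b ×ˢ univ) :=
      fun _ _ => ⟨hsub ht, mem_univ _⟩
    exact hasDerivWithinAt_univ.1 (h1.comp_hasDerivWithinAt ε h2.hasDerivWithinAt h3)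

variable {n : ℕ} {L : ℝ × ℝ × (Fin n → ℝ) → ℝ}

theorem fderivWithin_strip_curve (hL : ContDiffOn ℝ 1 L (Icc a b ×ˢ univ))
    {c : ℝ → ℝ × ℝ × (Fin n → ℝ)} {c' : ℝ × ℝ × (Fin n → ℝ)} {s : ℝ} (hc : HasDerivAt c c' s)
    (hcs : ∀ r, (c r).1 ∈ Icc a b) :
    deriv (fun r => L (c r)) s = fderivWithin ℝ L (Icc a b ×ˢ univ) (c s) c' := by
  have h1 := (hL.differentiableOn one_ne_zero (c s) ⟨hcs s, mem_univ _⟩).hasFDerivWithinAt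
  exact (hasDerivWithinAt_univ.1 (h1.comp_hasDerivWithinAt s hc.hasDerivWithinAt
    fun r _ => ⟨hcs r, mem_univ _⟩)).deriv

theorem partialState_eq (hL : ContDiffOn ℝ 1 L (Icc a b ×ˢ univ))
    {p : ℝ × ℝ × (Fin n → ℝ)} (hp : p.1 ∈ Icc a b) :
    partialState L p = fderivWithin ℝ L (Icc a b ×ˢ univ) p (0, 1, 0) :=
  fderivWithin_strip_curve (c := fun u => (p.1, u, p.2.2)) (s := p.2.1) hL
    ((hasDerivAt_const _ _).prodMk ((hasDerivAt_id _).prodMk (hasDerivAt_const _ _)))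
    fun _ => hp

theorem partialVel_eq (hL : ContDiffOn ℝ 1 L (Icc a b ×ˢ univ)) (i : Fin n)
    {p : ℝ × ℝ × (Fin n → ℝ)} (hp : p.1 ∈ Icc a b) :
    partialVel L i p = fderivWithin ℝ L (Icc a b ×ˢ univ) p (0, 0, Pi.single i 1) := by
  have h := fderivWithin_strip_curve (c := fun v => (p.1, p.2.1, Function.update p.2.2 i v))
    (s := p.2.2 i) hL ((hasDerivAt_const _ _).prodMk ((hasDerivAt_const _ _).prodMk
      (hasDerivAt_update p.2.2 i (p.2.2 i)))) fun _ => hp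
  rwa [Function.update_eq_self] at h

theorem fderivWithin_apply_eq (hL : ContDiffOn ℝ 1 L (Icc a b ×ˢ univ))
    {p : ℝ × ℝ × (Fin n → ℝ)} (hp : p.1 ∈ Icc a b) (u : ℝ) (v : Fin n → ℝ) :
    fderivWithin ℝ L (Icc a b ×ˢ univ) p (0, u, v) =
      partialState L p * u + ∑ i, partialVel L i p * v i := by
  have hv : ((0, u, v) : ℝ × ℝ × (Fin n → ℝ)) =
      u • (0, 1, 0) + ∑ i, v i • (0, 0, Pi.single i 1) := by
    refine Prod.ext (by simp [Prod.fst_sum]) (Prod.ext (by simp [Prod.snd_sum, Prod.fst_sum]) ?_)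
    simp only [Prod.snd_add, Prod.smul_snd, Prod.snd_sum, smul_zero, zero_add]
    exact pi_eq_sum_univ' v
  rw [hv, map_add, map_smul, map_sum, partialState_eq hL hp, smul_eq_mul, mul_comm]
  congr 1
  refine Finset.sum_congr rfl fun i _ => ?_
  rw [map_smul, partialVel_eq hL i hp, smul_eq_mul, mul_comm]

theorem continuousOn_partialState_comp (hab : a < b) (hL : ContDiffOn ℝ 1 L (Icc a b ×ˢ univ))
    {c : ℝ → ℝ × ℝ × (Fin n → ℝ)} (hc : ContinuousOn c (Icc a b))
    (hcs : ∀ t ∈ Icc a b, (c t).1 ∈ Icc a b) :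
    ContinuousOn (fun t => partialState L (c t)) (Icc a b) :=
  (((hL.continuousOn_fderivWithin (uniqueDiffOn_strip hab) le_rfl).comp hc
    fun t ht => ⟨hcs t ht, mem_univ _⟩).clm_apply continuousOn_const).congr
      fun t ht => partialState_eq hL (hcs t ht)

theorem continuousOn_partialVel_comp (hab : a < b) (hL : ContDiffOn ℝ 1 L (Icc a b ×ˢ univ))
    (i : Fin n) {c : ℝ → ℝ × ℝ × (Fin n → ℝ)} (hc : ContinuousOn c (Icc a b))
    (hcs : ∀ t ∈ Icc a b, (c t).1 ∈ Icc a b) :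
    ContinuousOn (fun t => partialVel L i (c t)) (Icc a b) :=
  (((hL.continuousOn_fderivWithin (uniqueDiffOn_strip hab) le_rfl).comp hc
    fun t ht => ⟨hcs t ht, mem_univ _⟩).clm_apply continuousOn_const).congr
      fun t ht => partialVel_eq hL i (hcs t ht)

end Lagrangian

/-! ### Admissible variations -/

section Variations

variable {n : ℕ} {a b T : ℝ} {α β : Fin n → ℝ → ℝ → ℝ} {γ₁ γ₂ : Fin n → ℝ}
  {L : ℝ × ℝ × (Fin n → ℝ) → ℝ} {φ : ℝ × ℝ → ℝ} {xa : Fin n → ℝ} {x h : ℝ → ℝ}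

theorem continuousOn_iteratedDerivWithin_succ (hab : a < b) (hh : ContDiffOn ℝ n h (Icc a b))
    (i : Fin n) : ContinuousOn (iteratedDerivWithin (i + 1) h (Icc a b)) (Icc a b) :=
  hh.continuousOn_iteratedDerivWithin (by exact_mod_cast i.isLt) (uniqueDiffOn_Icc hab)

theorem continuousOn_combinedCaputo (hab : a < b) (hα : IsOrderFamily α a b)
    (hβ : IsOrderFamily β a b) (hh : ContDiffOn ℝ n h (Icc a b)) (i : Fin n) :
    ContinuousOn (combinedCaputo α β γ₁ γ₂ a b i h) (Icc a b) := by
  have hc := continuousOn_iteratedDerivWithin_succ hab hh i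
  exact (continuousOn_const.mul (continuousOn_leftInt (hα.isFracOrder_compl i) hc)).add
    (continuousOn_const.mul (continuousOn_const.mul
      (continuousOn_rightInt (hβ.isFracOrder_compl i) hc)))

theorem iteratedDerivWithin_add_const_mul (hab : a < b) (hx : ContDiffOn ℝ n x (Icc a b))
    (hh : ContDiffOn ℝ n h (Icc a b)) {k : ℕ} (hk : k ≤ n) (ε : ℝ) {t : ℝ} (ht : t ∈ Icc a b) :
    iteratedDerivWithin k (fun s => x s + ε * h s) (Icc a b) t =
      iteratedDerivWithin k x (Icc a b) t + ε * iteratedDerivWithin k h (Icc a b) t := by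
  have hk' : (k : WithTop ℕ∞) ≤ n := by exact_mod_cast hk
  have hx' : ContDiffWithinAt ℝ k x (Icc a b) t := (hx t ht).of_le hk'
  have hh' : ContDiffWithinAt ℝ k h (Icc a b) t := (hh t ht).of_le hk'
  rw [iteratedDerivWithin_fun_add ht (uniqueDiffOn_Icc hab) hx' (contDiffWithinAt_const.mul hh'),
    iteratedDerivWithin_const_mul_field]

theorem combinedCaputo_add_const_mul (hab : a < b) (hα : IsOrderFamily α a b)
    (hβ : IsOrderFamily β a b) (hx : ContDiffOn ℝ n x (Icc a b)) (hh : ContDiffOn ℝ n h (Icc a b))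
    (i : Fin n) (ε : ℝ) {t : ℝ} (ht : t ∈ Icc a b) :
    combinedCaputo α β γ₁ γ₂ a b i (fun s => x s + ε * h s) t =
      combinedCaputo α β γ₁ γ₂ a b i x t + ε * combinedCaputo α β γ₁ γ₂ a b i h t := by
  have hcx := continuousOn_iteratedDerivWithin_succ hab hx i
  have hch := continuousOn_iteratedDerivWithin_succ hab hh i
  have hd : EqOn (iteratedDerivWithin (i + 1) (fun s => x s + ε * h s) (Icc a b))
      (fun s => iteratedDerivWithin (i + 1) x (Icc a b) s +
        ε * iteratedDerivWithin (i + 1) h (Icc a b) s) (Icc a b) := fun s hs =>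
    iteratedDerivWithin_add_const_mul hab hx hh i.isLt ε hs
  simp only [combinedCaputo, leftCaputo, rightCaputo]
  rw [leftInt_congr ht.1 (hd.mono (Icc_subset_Icc_right ht.2)),
    rightInt_congr ht.2 (hd.mono (Icc_subset_Icc_left ht.1)),
    leftInt_add_const_mul (hα.isFracOrder_compl i) hcx.isBddMeas hch.isBddMeas ε ht,
    rightInt_add_const_mul (hβ.isFracOrder_compl i) hcx hch ε ht]
  ring

theorem combinedCaputo_zero (i : Fin n) (t : ℝ) :
    combinedCaputo α β γ₁ γ₂ a b i (fun _ => 0) t = 0 := by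
  simp [combinedCaputo, leftCaputo, rightCaputo, leftInt, rightInt]

theorem exists_normD_le (hab : a < b) (hα : IsOrderFamily α a b)
    (hβ : IsOrderFamily β a b) (hh : ContDiffOn ℝ n h (Icc a b)) :
    ∃ M, ∀ ε s : ℝ, normD α β γ₁ γ₂ a b (fun t => ε * h t, s) ≤ |ε| * M + |s| := by
  have hne : (Icc a b).Nonempty := nonempty_Icc.2 hab.le
  obtain ⟨M, hM⟩ := isCompact_Icc.exists_bound_of_continuousOn hh.continuousOn
  obtain ⟨N, hN⟩ := isCompact_Icc.exists_bound_of_continuousOn (f := fun t =>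
    ∑ i, |combinedCaputo α β γ₁ γ₂ a b i h t|) (continuousOn_finsetSum _ fun i _ =>
      (continuousOn_combinedCaputo hab hα hβ hh i).abs)
  refine ⟨M + N, fun ε s => ?_⟩
  have h0 : ContDiffOn ℝ n (fun _ : ℝ => (0 : ℝ)) (Icc a b) := contDiffOn_const
  have h1 : sSup ((fun t => |ε * h t|) '' Icc a b) ≤ |ε| * M := by
    refine csSup_le (hne.image _) (forall_mem_image.2 fun t ht => ?_)
    rw [abs_mul]
    exact mul_le_mul_of_nonneg_left (hM t ht) (abs_nonneg _)
  have h2 : sSup ((fun t => ∑ i, |combinedCaputo α β γ₁ γ₂ a b i (fun t => ε * h t) t|) '' Icc a b)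
      ≤ |ε| * N := by
    refine csSup_le (hne.image _) (forall_mem_image.2 fun t ht => ?_)
    have : ∀ i, |combinedCaputo α β γ₁ γ₂ a b i (fun t => ε * h t) t| =
        |ε| * |combinedCaputo α β γ₁ γ₂ a b i h t| := fun i => by
      have := combinedCaputo_add_const_mul (γ₁ := γ₁) (γ₂ := γ₂) hab hα hβ h0 hh i ε ht
      simp only [zero_add, combinedCaputo_zero] at this
      rw [this, abs_mul]
    simp only [this]
    rw [← Finset.mul_sum]
    exact mul_le_mul_of_nonneg_left ((le_abs_self _).trans (hN t ht)) (abs_nonneg _)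
  simp only [normD]
  linarith

theorem add_const_mul_mem_Adm (hab : a < b) (hα : IsOrderFamily α a b) (hβ : IsOrderFamily β a b)
    (hp : (x, T) ∈ Adm α β γ₁ γ₂ a b xa) (hh : ContDiffOn ℝ n h (Icc a b))
    (h0 : ∀ i : Fin n, iteratedDerivWithin i h (Icc a b) a = 0) (ε : ℝ) {s : ℝ}
    (hs : s ∈ Icc a b) : (fun t => x t + ε * h t, s) ∈ Adm α β γ₁ γ₂ a b xa := by
  obtain ⟨⟨hx, -, -⟩, hi⟩ := hp
  have hxh : ContDiffOn ℝ n (fun t => x t + ε * h t) (Icc a b) :=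
    hx.add (contDiffOn_const.mul hh)
  refine ⟨⟨hxh, fun i => continuousOn_combinedCaputo hab hα hβ hxh i, hs⟩, fun i => ?_⟩
  have := iteratedDerivWithin_add_const_mul hab hx hh i.isLt.le ε (left_mem_Icc.2 hab.le)
  rw [this, h0 i, hi i, mul_zero, add_zero]

/-- Along any variation of state and terminal time that is continuous at `0`, the functional has a
local minimum. -/
theorem IsLocalMinimizer.isLocalMin_curve (hab : a < b) (hα : IsOrderFamily α a b)
    (hβ : IsOrderFamily β a b) (hmin : IsLocalMinimizer α β γ₁ γ₂ a b L φ xa (x, T))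
    (hh : ContDiffOn ℝ n h (Icc a b))
    (h0 : ∀ i : Fin n, iteratedDerivWithin i h (Icc a b) a = 0) {e τ : ℝ → ℝ} {r : ℝ}
    (he : ContinuousAt e r) (hτ : ContinuousAt τ r) (he0 : e r = 0) (hτ0 : τ r = T)
    (hT : T ∈ Ioo a b) :
    IsLocalMin (fun ε => cost α β γ₁ γ₂ a b L φ (fun t => x t + e ε * h t, τ ε)) r := by
  obtain ⟨hadm, δ, hδ, hloc⟩ := hmin
  obtain ⟨M, hM⟩ := exists_normD_le (γ₁ := γ₁) (γ₂ := γ₂) hab hα hβ hh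
  have hsmall : ∀ᶠ ε in 𝓝 r, |e ε| * M + |τ ε - T| < δ := by
    have hc : ContinuousAt (fun ε => |e ε| * M + |τ ε - T|) r :=
      (he.abs.mul continuousAt_const).add (hτ.sub continuousAt_const).abs
    refine hc.eventually_lt continuousAt_const ?_
    simpa [he0, hτ0] using hδ
  have hmem : ∀ᶠ ε in 𝓝 r, τ ε ∈ Icc a b :=
    hτ.eventually_mem (by rw [hτ0]; exact Icc_mem_nhds hT.1 hT.2)
  filter_upwards [hsmall, hmem] with ε hε hm
  have hx : (fun t => x t + e r * h t) = x := by ext t; simp [he0]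
  simp only [hx, hτ0]
  refine hloc _ (add_const_mul_mem_Adm hab hα hβ hadm hh h0 _ hm) (lt_of_le_of_lt ?_ hε)
  have : ((fun t => x t + e ε * h t, τ ε) : (ℝ → ℝ) × ℝ) - (x, T) =
      (fun t => e ε * h t, τ ε - T) := by
    refine Prod.ext ?_ rfl
    ext t
    simp
  rw [this]
  exact hM _ _

theorem differentiableAt_terminalCost (hφ : ContDiffOn ℝ 1 φ (Icc a b ×ˢ univ)) (hT : T ∈ Ioo a b)
    (u : ℝ) : DifferentiableAt ℝ φ (T, u) :=
  (hφ.differentiableOn one_ne_zero _ ⟨Ioo_subset_Icc_self hT, mem_univ _⟩).differentiableAt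
    (prod_mem_nhds (Icc_mem_nhds hT.1 hT.2) univ_mem)

theorem continuousOn_args (hx : ContinuousOn x (Icc a b))
    (hc : ∀ i, ContinuousOn (combinedCaputo α β γ₁ γ₂ a b i x) (Icc a b)) :
    ContinuousOn (args α β γ₁ γ₂ a b x) (Icc a b) :=
  continuousOn_id.prodMk (hx.prodMk (continuousOn_pi.2 hc))

/-- The transversality condition for the terminal time: the state is kept, only `T` varies. -/
theorem IsLocalMinimizer.terminal_time (hn : 1 ≤ n) (hα : IsOrderFamily α a b)
    (hβ : IsOrderFamily β a b) (hL : ContDiffOn ℝ 1 L (Icc a b ×ˢ univ))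
    (hφ : ContDiffOn ℝ 1 φ (Icc a b ×ˢ univ))
    (hmin : IsLocalMinimizer α β γ₁ γ₂ a b L φ xa (x, T)) (hT : T ∈ Ioo a b) :
    L (args α β γ₁ γ₂ a b x T) + deriv (fun s => φ (s, x T)) T +
      deriv (fun u => φ (T, u)) (x T) * derivWithin x (Icc a b) T = 0 := by
  have hab : a < b := hT.1.trans hT.2
  obtain ⟨⟨hx, hc, -⟩, -⟩ := hmin.1
  have hnhds : Icc a b ∈ 𝓝 T := Icc_mem_nhds hT.1 hT.2
  have hloc := hmin.isLocalMin_curve hab hα hβ (h := fun _ => 0) contDiffOn_const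
    (fun i => by simp) (e := fun _ => 0) (τ := id) (r := T)
    continuousAt_const continuousAt_id rfl rfl hT
  simp only [mul_zero, add_zero, cost, id] at hloc
  have hLx : ContinuousOn (fun t => L (args α β γ₁ γ₂ a b x t)) (Icc a b) :=
    hL.continuousOn.comp (continuousOn_args hx.continuousOn hc) fun t ht => ⟨ht, mem_univ _⟩
  have h1 : HasDerivAt (fun s => ∫ t in a..s, L (args α β γ₁ γ₂ a b x t))
      (L (args α β γ₁ γ₂ a b x T)) T :=
    (hasDerivWithinAt_prim Subset.rfl (left_mem_Icc.2 hab.le)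
      (hLx.intervalIntegrable_of_Icc hab.le) hLx (Ioo_subset_Icc_self hT)).hasDerivAt hnhds
  have h2 : HasDerivAt x (derivWithin x (Icc a b) T) T :=
    ((hx.differentiableOn (by exact_mod_cast (by omega : n ≠ 0)) T
      (Ioo_subset_Icc_self hT)).hasDerivWithinAt).hasDerivAt hnhds
  have hφ' := (differentiableAt_terminalCost hφ hT (x T)).hasFDerivAt
  have h3 := hφ'.comp_hasDerivAt T ((hasDerivAt_id T).prodMk h2)
  have h4 := (hφ'.comp_hasDerivAt T ((hasDerivAt_id T).prodMk (hasDerivAt_const T (x T)))).deriv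
  have h5 := (hφ'.comp_hasDerivAt (x T)
    ((hasDerivAt_const (x T) T).prodMk (hasDerivAt_id (x T)))).deriv
  have h6 := hloc.hasDerivAt_eq_zero (h1.add h3)
  have h7 : ((1, derivWithin x (Icc a b) T) : ℝ × ℝ) =
      (1, 0) + derivWithin x (Icc a b) T • ((0, 1) : ℝ × ℝ) := by ext <;> simp
  rw [h7, map_add, map_smul, smul_eq_mul] at h6
  simp only [Function.comp_def, id] at h4 h5
  rw [h4, h5]
  linarith

/-- The first variation of the functional vanishes in all directions `h` whose derivatives of order
below `n` vanish at `a`. -/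
theorem IsLocalMinimizer.first_variation (hα : IsOrderFamily α a b)
    (hβ : IsOrderFamily β a b) (hL : ContDiffOn ℝ 1 L (Icc a b ×ˢ univ))
    (hφ : ContDiffOn ℝ 1 φ (Icc a b ×ˢ univ))
    (hmin : IsLocalMinimizer α β γ₁ γ₂ a b L φ xa (x, T)) (hT : T ∈ Ioo a b)
    (hh : ContDiffOn ℝ n h (Icc a b))
    (h0 : ∀ i : Fin n, iteratedDerivWithin i h (Icc a b) a = 0) :
    (∫ t in a..T, (partialState L (args α β γ₁ γ₂ a b x t) * h t +
        ∑ i, partialVel L i (args α β γ₁ γ₂ a b x t) * combinedCaputo α β γ₁ γ₂ a b i h t)) +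
      deriv (fun u => φ (T, u)) (x T) * h T = 0 := by
  have hab : a < b := hT.1.trans hT.2
  obtain ⟨⟨hx, hc, -⟩, -⟩ := hmin.1
  have hloc := hmin.isLocalMin_curve hab hα hβ hh h0 (e := id) (τ := fun _ => T) (r := 0)
    continuousAt_id continuousAt_const rfl rfl hT
  have hsub : ∀ t ∈ uIcc a T, t ∈ Icc a b := fun t ht => by
    rw [uIcc_of_le hT.1.le] at ht
    exact ⟨ht.1, ht.2.trans hT.2.le⟩
  have hcost : (fun ε : ℝ => cost α β γ₁ γ₂ a b L φ (fun t => x t + id ε * h t, T)) = fun ε =>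
      (∫ t in a..T, L (t, (x t, fun i => combinedCaputo α β γ₁ γ₂ a b i x t) +
        ε • (h t, fun i => combinedCaputo α β γ₁ γ₂ a b i h t))) + φ (T, x T + ε * h T) := by
    ext ε
    simp only [cost, id]
    congr 1
    refine intervalIntegral.integral_congr fun t ht => ?_
    simp only [args]
    congr 2
    refine Prod.ext rfl (funext fun i => ?_)
    exact combinedCaputo_add_const_mul hab hα hβ hx hh i ε (hsub t ht)
  rw [hcost] at hloc
  have h1 := hasDerivAt_integral_lagrangian hab hL
    (X := fun t => (x t, fun i => combinedCaputo α β γ₁ γ₂ a b i x t))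
    (H := fun t => (h t, fun i => combinedCaputo α β γ₁ γ₂ a b i h t))
    (hx.continuousOn.prodMk (continuousOn_pi.2 hc))
    (hh.continuousOn.prodMk (continuousOn_pi.2 fun i => continuousOn_combinedCaputo hab hα hβ hh i))
    (Ioo_subset_Icc_self hT)
  have h2 : HasDerivAt (fun ε : ℝ => φ (T, x T + ε * h T))
      (deriv (fun u => φ (T, u)) (x T) * h T) 0 := by
    have hd : DifferentiableAt ℝ (fun u => φ (T, u)) (x T + 0 * h T) := by
      have := differentiableAt_terminalCost hφ hT (x T + 0 * h T)
      exact this.comp (x T + 0 * h T) (by fun_prop)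
    have hl : HasDerivAt (fun ε : ℝ => x T + ε * h T) (h T) 0 := by
      simpa using ((hasDerivAt_id (0 : ℝ)).mul_const (h T)).const_add (x T)
    simpa [Function.comp_def] using hd.hasDerivAt.comp (0 : ℝ) hl
  have h3 := hloc.hasDerivAt_eq_zero (h1.add h2)
  rw [← h3]
  congr 1
  refine intervalIntegral.integral_congr fun t ht => ?_
  exact (fderivWithin_apply_eq hL (p := args α β γ₁ γ₂ a b x t) (hsub t ht) _ _).symm

end Variations

/-! ### The costate functions -/

/-- The factor of the derivative of order `i + 1` of the direction in the first variation, after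
fractional integration by parts. Cutting `y i` and `P` off after `T` puts the conditions on `[a,T]`
and on `[T,b]` into one function, which is continuous on the whole of `[a,b]`. The partial
derivative `P` of the Lagrangian with respect to the state is integrated once and joins the
index `0`. -/
noncomputable def costate {n : ℕ} (α β : Fin n → ℝ → ℝ → ℝ) (γ₁ γ₂ : Fin n → ℝ) (a b T : ℝ)
    (P : ℝ → ℝ) (y : Fin n → ℝ → ℝ) (i : Fin n) (t : ℝ) : ℝ :=
  γ₁ i * ((-1) ^ ((i : ℕ) + 1) * rightInt (compl (i + 1) (α i)) b ((Iic T).indicator (y i)) t) +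
    γ₂ i * leftInt (compl (i + 1) (β i)) a ((Iic T).indicator (y i)) t +
    if (i : ℕ) = 0 then prim b ((Iic T).indicator P) t else 0

section Costate

variable {n : ℕ} {a b T t : ℝ} {α β : Fin n → ℝ → ℝ → ℝ} {γ₁ γ₂ : Fin n → ℝ}
  {P : ℝ → ℝ} {y : Fin n → ℝ → ℝ}

theorem prim_indicator_of_ge (f : ℝ → ℝ) (hTt : T ≤ t) (htb : t ≤ b) :
    prim b ((Iic T).indicator f) t = 0 := by
  rw [prim, intervalIntegral.integral_symm, intervalIntegral.integral_of_le htb, neg_eq_zero]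
  exact setIntegral_eq_zero_of_forall_eq_zero fun s hs =>
    indicator_of_notMem (show s ∉ Iic T from not_le.2 (hTt.trans_lt hs.1)) _

theorem costate_of_le (hT : T ≤ b) (i : Fin n) (ht : t ∈ Icc a T) :
    costate α β γ₁ γ₂ a b T P y i t =
      γ₁ i * ((-1) ^ ((i : ℕ) + 1) * rightInt (compl (i + 1) (α i)) T (y i) t) +
        γ₂ i * leftInt (compl (i + 1) (β i)) a (y i) t +
        if (i : ℕ) = 0 then prim b ((Iic T).indicator P) t else 0 := by
  rw [costate, rightInt_indicator_of_le ht.2 hT, leftInt_indicator_of_le ht.1 ht.2]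

theorem costate_of_ge (hβ : IsOrderFamily β a b) (hy : ∀ i, ContinuousOn (y i) (Icc a b))
    (hT : a ≤ T) (i : Fin n) (ht : t ∈ Icc T b) :
    costate α β γ₁ γ₂ a b T P y i t = γ₂ i * (leftInt (compl (i + 1) (β i)) a (y i) t -
      leftInt (compl (i + 1) (β i)) T (y i) t) := by
  rw [costate, rightInt_indicator_of_ge ht.1 ht.2, prim_indicator_of_ge P ht.1 ht.2,
    leftInt_indicator_of_ge (hβ.isFracOrder_compl i) (hy i) hT ht.1 ht.2]
  simp

theorem continuousOn_costate (hα : IsOrderFamily α a b) (hβ : IsOrderFamily β a b)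
    (hP : ContinuousOn P (Icc a b)) (hy : ∀ i, ContinuousOn (y i) (Icc a b)) (hT : T ∈ Ioo a b)
    (i : Fin n) : ContinuousOn (costate α β γ₁ γ₂ a b T P y i) (Icc a b) := by
  have hab : a ≤ b := (hT.1.trans hT.2).le
  refine ((continuousOn_const.mul (continuousOn_const.mul (continuousOn_rightInt_indicator
    (hα.isFracOrder_compl i) (hy i) hT.1.le hT.2.le))).add (continuousOn_const.mul
    (continuousOn_leftInt_indicator (hβ.isFracOrder_compl i) (hy i) hT.1.le hT.2.le))).add ?_
  split_ifs
  · exact continuousOn_prim (right_mem_Icc.2 hab)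
      ((hP.isBddMeas.indicator measurableSet_Iic).intervalIntegrable hab)
  · exact continuousOn_const

theorem hasNthDeriv_costate_left (hT : T ∈ Ioo a b) (i : Fin n) (ht : t ∈ Icc a T) {k : ℕ} {v : ℝ}
    (hA : γ₂ i ≠ 0 → LeftIntDerivExists k (i + 1) (β i) a b (y i) t)
    (hR : γ₁ i ≠ 0 → RightIntDerivExists k (i + 1) (α i) a T (y i) t)
    (hV : HasNthDeriv k (fun s => if (i : ℕ) = 0 then prim b ((Iic T).indicator P) s else 0)
      (Icc a T) t v) :
    HasNthDeriv k (costate α β γ₁ γ₂ a b T P y i) (Icc a T) t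
      (γ₁ i * ((-1) ^ ((i : ℕ) + 1) * rightIntDeriv k (i + 1) (α i) a T (y i) t) +
        γ₂ i * leftIntDeriv k (i + 1) (β i) a b (y i) t + v) :=
  (((HasNthDeriv.const_mul_of_ne fun h => (hR h).hasNthDeriv.const_mul _).add
    (HasNthDeriv.const_mul_of_ne fun h =>
      (hA h).hasNthDeriv.mono (Icc_subset_Icc_right hT.2.le))).add hV).congr
    (fun _ hs => costate_of_le hT.2.le i hs) ht

theorem hasNthDeriv_costate_right (hβ : IsOrderFamily β a b)
    (hy : ∀ i, ContinuousOn (y i) (Icc a b)) (hT : T ∈ Ioo a b) (i : Fin n) (ht : t ∈ Icc T b)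
    {k : ℕ} (hA : γ₂ i ≠ 0 → LeftIntDerivExists k (i + 1) (β i) a b (y i) t ∧
      LeftIntDerivExists k (i + 1) (β i) T b (y i) t) :
    HasNthDeriv k (costate α β γ₁ γ₂ a b T P y i) (Icc T b) t
      (γ₂ i * (leftIntDeriv k (i + 1) (β i) a b (y i) t -
        leftIntDeriv k (i + 1) (β i) T b (y i) t)) := by
  refine HasNthDeriv.congr (HasNthDeriv.const_mul_of_ne fun h => ?_)
    (fun _ hs => costate_of_ge hβ hy hT.1.le i hs) ht
  exact ((hA h).1.hasNthDeriv.mono (Icc_subset_Icc_left hT.1.le)).add (hA h).2.hasNthDeriv.neg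

/-- Integration by parts in the first variation: all derivatives are shifted to the direction. -/
theorem integral_first_variation (hn : 1 ≤ n) (hα : IsOrderFamily α a b) (hβ : IsOrderFamily β a b)
    (hP : ContinuousOn P (Icc a b)) (hy : ∀ i, ContinuousOn (y i) (Icc a b)) (hT : T ∈ Ioo a b)
    {g : ℝ → ℝ} (hg : Continuous g) :
    ∫ t in a..T, (P t * (prim a)^[n] g t +
        ∑ i, y i t * combinedCaputo α β γ₁ γ₂ a b i ((prim a)^[n] g) t) =
      ∑ i : Fin n, (-1) ^ ((i : ℕ) + 1) *
        ∫ t in a..b, (prim a)^[n - 1 - i] g t * costate α β γ₁ γ₂ a b T P y i t := by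
  have hab : a < b := hT.1.trans hT.2
  have ha : a ∈ Icc a b := left_mem_Icc.2 hab.le
  have hb : b ∈ Icc a b := right_mem_Icc.2 hab.le
  have hsub : Icc a T ⊆ Icc a b := Icc_subset_Icc_right hT.2.le
  have hG : ∀ k, Continuous ((prim a)^[k] g) := fun k => (contDiff_prim_iterate a hg k).continuous
  have hyT : ∀ i, IsBddMeas ((Iic T).indicator (y i)) a b := fun i =>
    (hy i).isBddMeas.indicator measurableSet_Iic
  have hPT : IsBddMeas ((Iic T).indicator P) a b := hP.isBddMeas.indicator measurableSet_Iic
  have hcut : ∀ f u : ℝ → ℝ, ∫ t in a..T, f t * u t = ∫ t in a..b, (Iic T).indicator f t * u t := by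
    intro f u
    rw [← intervalIntegral_indicator_Iic hT.1.le hT.2.le]
    refine intervalIntegral.integral_congr fun t _ => ?_
    simp only [indicator_apply]
    split_ifs <;> simp
  have hCc : ∀ i : Fin n,
      ContinuousOn (combinedCaputo α β γ₁ γ₂ a b i ((prim a)^[n] g)) (Icc a b) := fun i =>
    continuousOn_combinedCaputo hab hα hβ (contDiff_prim_iterate a hg n).contDiffOn i
  have hC : ∀ i : Fin n, ∀ t ∈ Icc a b, combinedCaputo α β γ₁ γ₂ a b i ((prim a)^[n] g) t =
      γ₁ i * leftInt (compl (i + 1) (α i)) a ((prim a)^[n - 1 - i] g) t +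
      γ₂ i * ((-1) ^ ((i : ℕ) + 1) *
        rightInt (compl (i + 1) (β i)) b ((prim a)^[n - 1 - i] g) t) := by
    intro i t ht
    have hd : EqOn (iteratedDerivWithin (i + 1) ((prim a)^[n] g) (Icc a b))
        ((prim a)^[n - 1 - i] g) (Icc a b) := fun s hs => by
      have := iteratedDerivWithin_prim_iterate hab ha hg.continuousOn hs (i + 1) (n - 1 - i)
      rwa [show (i : ℕ) + 1 + (n - 1 - i) = n by omega] at this
    rw [combinedCaputo, leftCaputo, rightCaputo,
      leftInt_congr ht.1 (hd.mono (Icc_subset_Icc_right ht.2)),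
      rightInt_congr ht.2 (hd.mono (Icc_subset_Icc_left ht.1))]
  have hstate : ∫ t in a..T, P t * (prim a)^[n] g t =
      -∫ t in a..b, (prim a)^[n - 1] g t * prim b ((Iic T).indicator P) t := by
    rw [hcut, ← integral_prim_mul hab.le hPT (hG _).continuousOn.isBddMeas,
      ← Function.iterate_succ_apply' (prim a), Nat.succ_eq_add_one, Nat.sub_add_cancel hn]
    simp only [mul_comm]
  -- both kinds of fractional integrals change sides; the factor `(-1)^(i+1)` cancels its square
  have hvel : ∀ i : Fin n, ∫ t in a..T, y i t * combinedCaputo α β γ₁ γ₂ a b i ((prim a)^[n] g) t =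
      (-1) ^ ((i : ℕ) + 1) * ∫ t in a..b, (prim a)^[n - 1 - i] g t *
        (γ₁ i * ((-1) ^ ((i : ℕ) + 1) *
          rightInt (compl (i + 1) (α i)) b ((Iic T).indicator (y i)) t) +
        γ₂ i * leftInt (compl (i + 1) (β i)) a ((Iic T).indicator (y i)) t) := by
    intro i
    have hνα := hα.isFracOrder_compl i
    have hνβ := hβ.isFracOrder_compl i
    have hGc : ContinuousOn ((prim a)^[n - 1 - i] g) (Icc a b) := (hG _).continuousOn
    have i1 := ((hyT i).intervalIntegrable hab.le).mul_continuousOn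
      ((continuousOn_leftInt hνα hGc).mono (uIcc_of_le hab.le).subset)
    have i2 := ((hyT i).intervalIntegrable hab.le).mul_continuousOn
      ((continuousOn_rightInt hνβ hGc).mono (uIcc_of_le hab.le).subset)
    have i3 := intervalIntegrable_mul_of_continuousOn hab.le hGc
      (continuousOn_rightInt_indicator hνα (hy i) hT.1.le hT.2.le)
    have i4 := intervalIntegrable_mul_of_continuousOn hab.le hGc
      (continuousOn_leftInt_indicator hνβ (hy i) hT.1.le hT.2.le)
    have s1 := integral_mul_leftInt hνα hab.le (hyT i) hGc.isBddMeas
    have s2 := integral_mul_leftInt hνβ hab.le hGc.isBddMeas (hyT i)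
    have hsq : ((-1 : ℝ) ^ ((i : ℕ) + 1)) * (-1) ^ ((i : ℕ) + 1) = 1 := by
      rw [← mul_pow]; simp
    rw [hcut]
    calc _ = ∫ t in a..b, (γ₁ i * ((Iic T).indicator (y i) t *
            leftInt (compl (i + 1) (α i)) a ((prim a)^[n - 1 - i] g) t) +
          γ₂ i * (-1) ^ ((i : ℕ) + 1) * ((Iic T).indicator (y i) t *
            rightInt (compl (i + 1) (β i)) b ((prim a)^[n - 1 - i] g) t)) := by
          refine intervalIntegral.integral_congr fun t ht => ?_
          rw [uIcc_of_le hab.le] at ht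
          simp only [hC i t ht]
          ring
      _ = γ₁ i * (∫ t in a..b, (prim a)^[n - 1 - i] g t *
            rightInt (compl (i + 1) (α i)) b ((Iic T).indicator (y i)) t) +
          γ₂ i * (-1) ^ ((i : ℕ) + 1) * ∫ t in a..b, (prim a)^[n - 1 - i] g t *
            leftInt (compl (i + 1) (β i)) a ((Iic T).indicator (y i)) t := by
          rw [intervalIntegral.integral_add (i1.const_mul _) (i2.const_mul _),
            intervalIntegral.integral_const_mul, intervalIntegral.integral_const_mul, s1, s2]
      _ = (-1) ^ ((i : ℕ) + 1) * (γ₁ i * (-1) ^ ((i : ℕ) + 1) *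
            (∫ t in a..b, (prim a)^[n - 1 - i] g t *
              rightInt (compl (i + 1) (α i)) b ((Iic T).indicator (y i)) t) +
          γ₂ i * ∫ t in a..b, (prim a)^[n - 1 - i] g t *
            leftInt (compl (i + 1) (β i)) a ((Iic T).indicator (y i)) t) := by
          linear_combination (-γ₁ i * ∫ t in a..b, (prim a)^[n - 1 - i] g t *
            rightInt (compl (i + 1) (α i)) b ((Iic T).indicator (y i)) t) * hsq
      _ = _ := by
          rw [← intervalIntegral.integral_const_mul, ← intervalIntegral.integral_const_mul,
            ← intervalIntegral.integral_add (i3.const_mul _) (i4.const_mul _)]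
          congr 1
          refine intervalIntegral.integral_congr fun t _ => ?_
          ring
  have hsplit : ∀ i : Fin n, (-1) ^ ((i : ℕ) + 1) *
      (∫ t in a..b, (prim a)^[n - 1 - i] g t * costate α β γ₁ γ₂ a b T P y i t) =
      (∫ t in a..T, y i t * combinedCaputo α β γ₁ γ₂ a b i ((prim a)^[n] g) t) +
      if (i : ℕ) = 0 then
        -∫ t in a..b, (prim a)^[n - 1] g t * prim b ((Iic T).indicator P) t else 0 := by
    intro i
    rw [hvel i]
    have hGc : ContinuousOn ((prim a)^[n - 1 - i] g) (Icc a b) := (hG _).continuousOn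
    have hW : ContinuousOn (fun t => γ₁ i * ((-1) ^ ((i : ℕ) + 1) *
          rightInt (compl (i + 1) (α i)) b ((Iic T).indicator (y i)) t) +
        γ₂ i * leftInt (compl (i + 1) (β i)) a ((Iic T).indicator (y i)) t) (Icc a b) :=
      (continuousOn_const.mul (continuousOn_const.mul (continuousOn_rightInt_indicator
        (hα.isFracOrder_compl i) (hy i) hT.1.le hT.2.le))).add (continuousOn_const.mul
        (continuousOn_leftInt_indicator (hβ.isFracOrder_compl i) (hy i) hT.1.le hT.2.le))
    by_cases h0 : (i : ℕ) = 0
    · have hV : ContinuousOn (prim b ((Iic T).indicator P)) (Icc a b) :=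
        continuousOn_prim hb (hPT.intervalIntegrable hab.le)
      simp only [costate, if_pos h0, mul_add _ _ (prim b _ _)]
      rw [intervalIntegral.integral_add (intervalIntegrable_mul_of_continuousOn hab.le hGc hW)
        (intervalIntegrable_mul_of_continuousOn hab.le hGc hV), mul_add, h0]
      simp
    · simp only [costate, if_neg h0, add_zero]
  have hcont : ∀ i, IntervalIntegrable (fun t => y i t *
      combinedCaputo α β γ₁ γ₂ a b i ((prim a)^[n] g) t) volume a T := fun i =>
    intervalIntegrable_mul_of_continuousOn hT.1.le ((hy i).mono hsub) ((hCc i).mono hsub)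
  have hcsum : IntervalIntegrable (fun t => ∑ i, y i t *
      combinedCaputo α β γ₁ γ₂ a b i ((prim a)^[n] g) t) volume a T :=
    ContinuousOn.intervalIntegrable_of_Icc hT.1.le
      (continuousOn_finsetSum _ fun i _ => ((hy i).mul (hCc i)).mono hsub)
  rw [Finset.sum_congr rfl fun i _ => hsplit i, Finset.sum_add_distrib,
    intervalIntegral.integral_add
      (intervalIntegrable_mul_of_continuousOn hT.1.le (hP.mono hsub) (hG n).continuousOn)
      hcsum,
    intervalIntegral.integral_finsetSum fun i _ => hcont i, hstate, add_comm]
  congr 1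
  rw [Finset.sum_eq_single (⟨0, hn⟩ : Fin n)]
  · simp
  · intro i _ hi
    exact if_neg fun h => hi (Fin.ext h)
  · simp

end Costate

/-! ### The necessary conditions -/

section NecessaryConditions

variable {n : ℕ} {a b T t : ℝ} {α β : Fin n → ℝ → ℝ → ℝ} {γ₁ γ₂ : Fin n → ℝ}
  {P : ℝ → ℝ} {y : Fin n → ℝ → ℝ} {κ : ℝ}

theorem euler_lagrange_left (hn : 1 ≤ n) (hα : IsOrderFamily α a b) (hβ : IsOrderFamily β a b)
    (hP : ContinuousOn P (Icc a b)) (hy : ∀ i, ContinuousOn (y i) (Icc a b)) (hT : T ∈ Ioo a b)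
    (hQ : EqOn (primSum b (costate α β γ₁ γ₂ a b T P y))
      (fun t => κ * stepPrim T b (n - 1) t) (Icc a T)) (ht : t ∈ Icc a T)
    (hA : ∀ i, γ₂ i ≠ 0 → LeftRLExists (i + 1) (β i) a b (y i) t)
    (hR : ∀ i, γ₁ i ≠ 0 → RightRLExists (i + 1) (α i) a T (y i) t) :
    P t + ∑ i : Fin n, (γ₂ i * leftRL (i + 1) (β i) a b (y i) t +
      γ₁ i * rightRL (i + 1) (α i) a T (y i) t) = 0 := by
  have hab : a ≤ b := (hT.1.trans hT.2).le
  have hsub : Icc a T ⊆ Icc a b := Icc_subset_Icc_right hT.2.le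
  have hV : ∀ i : Fin n, HasNthDeriv (i + 1)
      (fun s => if (i : ℕ) = 0 then prim b ((Iic T).indicator P) s else 0) (Icc a T) t
      (if (i : ℕ) = 0 then P t else 0) := by
    intro i
    by_cases h0 : (i : ℕ) = 0
    · simp only [h0, if_true]
      have hcut : EqOn ((Iic T).indicator P) P (Icc a T) := fun s hs =>
        indicator_of_mem (show s ∈ Iic T from hs.2) _
      exact HasNthDeriv.primitive (k := 0) (hcut ht) ht fun s hs =>
        hasDerivWithinAt_prim hsub (right_mem_Icc.2 hab)
          ((hP.isBddMeas.indicator measurableSet_Iic).intervalIntegrable hab)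
          ((hP.mono hsub).congr hcut) hs
    · simp only [h0, if_false]
      exact HasNthDeriv.zero
  have h1 := hasNthDeriv_primSum_top hab (continuousOn_costate hα hβ hP hy hT) hsub ht
    fun i => hasNthDeriv_costate_left hT i ht (hA i) (hR i) (hV i)
  have h2 := ((hasNthDeriv_stepPrim_top hT hn ht).const_mul κ).congr hQ ht
  have h3 := h1.unique h2 ht (uniqueDiffOn_Icc hT.1)
  rw [mul_zero, Finset.sum_add_distrib, add_comm] at h3
  have h4 : ∑ i : Fin n, (if (i : ℕ) = 0 then P t else 0) = P t := by
    rw [Finset.sum_eq_single (⟨0, hn⟩ : Fin n)]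
    · simp
    · intro i _ hi
      exact if_neg fun h => hi (Fin.ext h)
    · simp
  rw [h4] at h3
  rw [← h3]
  congr 1
  exact Finset.sum_congr rfl fun i _ => add_comm _ _

theorem euler_lagrange_right (hα : IsOrderFamily α a b) (hβ : IsOrderFamily β a b)
    (hP : ContinuousOn P (Icc a b)) (hy : ∀ i, ContinuousOn (y i) (Icc a b)) (hT : T ∈ Ioo a b)
    (hQ : EqOn (primSum b (costate α β γ₁ γ₂ a b T P y)) 0 (Icc T b)) (ht : t ∈ Icc T b)
    (hA : ∀ i, γ₂ i ≠ 0 → LeftRLExists (i + 1) (β i) a b (y i) t ∧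
      LeftRLExists (i + 1) (β i) T b (y i) t) :
    ∑ i : Fin n, γ₂ i * (leftRL (i + 1) (β i) a b (y i) t -
      leftRL (i + 1) (β i) T b (y i) t) = 0 :=
  (hasNthDeriv_primSum_top (hT.1.trans hT.2).le (continuousOn_costate hα hβ hP hy hT)
    (Icc_subset_Icc_left hT.1.le) ht fun i =>
      hasNthDeriv_costate_right hβ hy hT i ht (hA i)).unique
    (HasNthDeriv.zero.congr hQ ht) ht (uniqueDiffOn_Icc hT.2)

/-- The derivatives from the left and from the right of the integrated conditions at `T` share the
terms with primitives, which are continuous; their difference leaves the boundary terms at `T`. The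
integrals from `a` cancel, because their two-sided derivative at `T` exists. -/
theorem transversality_at_T (hα : IsOrderFamily α a b) (hβ : IsOrderFamily β a b)
    (hP : ContinuousOn P (Icc a b)) (hy : ∀ i, ContinuousOn (y i) (Icc a b)) (hT : T ∈ Ioo a b)
    (hQl : EqOn (primSum b (costate α β γ₁ γ₂ a b T P y))
      (fun t => κ * stepPrim T b (n - 1) t) (Icc a T))
    (hQr : EqOn (primSum b (costate α β γ₁ γ₂ a b T P y)) 0 (Icc T b)) {j : ℕ} (hj : j ≤ n - 1)
    (h : ∀ i : Fin n, j ≤ i →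
      (γ₁ i ≠ 0 → RightIntDerivExists (i - j) (i + 1) (α i) a T (y i) T) ∧
      (γ₂ i ≠ 0 → LeftIntDerivExists (i - j) (i + 1) (β i) a b (y i) T ∧
        LeftIntDerivExists (i - j) (i + 1) (β i) T b (y i) T)) :
    ∑ i ∈ Finset.univ.filter (fun i : Fin n => j ≤ (i : ℕ)),
      (γ₁ i * ((-1) ^ ((i : ℕ) + 1) * rightIntDeriv (i - j) (i + 1) (α i) a T (y i) T) +
        γ₂ i * leftIntDeriv (i - j) (i + 1) (β i) T b (y i) T) = κ * stepPrim T b j T := by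
  have hab : a ≤ b := (hT.1.trans hT.2).le
  have hTl : T ∈ Icc a T := right_mem_Icc.2 hT.1.le
  have hTr : T ∈ Icc T b := left_mem_Icc.2 hT.2.le
  have hF := continuousOn_costate (γ₁ := γ₁) (γ₂ := γ₂) hα hβ hP hy hT
  have hV : ∀ i : Fin n, j ≤ i → HasNthDeriv (i - j)
      (fun s => if (i : ℕ) = 0 then prim b ((Iic T).indicator P) s else 0) (Icc a T) T 0 := by
    intro i hi
    by_cases h0 : (i : ℕ) = 0
    · simp only [h0, if_true, Nat.zero_sub]
      exact prim_indicator_of_ge P le_rfl hT.2.le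
    · simp only [h0, if_false]
      exact HasNthDeriv.zero
  have hl := (hasNthDeriv_primSum hab hF (Icc_subset_Icc_right hT.2.le) hTl hj
    fun i hi => hasNthDeriv_costate_left hT i hTl (fun h2 => ((h i hi).2 h2).1) (h i hi).1
      (hV i hi)).unique
    (((hasNthDeriv_stepPrim hT hTl hj).const_mul κ).congr hQl hTl) hTl (uniqueDiffOn_Icc hT.1)
  have hr := (hasNthDeriv_primSum hab hF (Icc_subset_Icc_left hT.1.le) hTr hj
    fun i hi => hasNthDeriv_costate_right hβ hy hT i hTr (h i hi).2).unique
    (HasNthDeriv.zero.congr hQr hTr) hTr (uniqueDiffOn_Icc hT.2)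
  have hd := congrArg₂ (· - ·) hl hr
  simp only [sub_zero, add_sub_add_right_eq_sub, ← Finset.sum_sub_distrib] at hd
  rw [← hd]
  exact Finset.sum_congr rfl fun i _ => by ring

theorem transversality_at_b (hα : IsOrderFamily α a b) (hβ : IsOrderFamily β a b)
    (hP : ContinuousOn P (Icc a b)) (hy : ∀ i, ContinuousOn (y i) (Icc a b)) (hT : T ∈ Ioo a b)
    (hQ : EqOn (primSum b (costate α β γ₁ γ₂ a b T P y)) 0 (Icc T b)) {j : ℕ} (hj : j ≤ n - 1)
    (h : ∀ i : Fin n, j ≤ i → γ₂ i ≠ 0 →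
      LeftIntDerivExists (i - j) (i + 1) (β i) a b (y i) b ∧
      LeftIntDerivExists (i - j) (i + 1) (β i) T b (y i) b) :
    ∑ i ∈ Finset.univ.filter (fun i : Fin n => j ≤ (i : ℕ)),
      γ₂ i * (leftIntDeriv (i - j) (i + 1) (β i) a b (y i) b -
        leftIntDeriv (i - j) (i + 1) (β i) T b (y i) b) = 0 := by
  have hb : b ∈ Icc T b := right_mem_Icc.2 hT.2.le
  have hr := (hasNthDeriv_primSum (hT.1.trans hT.2).le
    (continuousOn_costate (γ₁ := γ₁) hα hβ hP hy hT) (Icc_subset_Icc_left hT.1.le) hb hj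
    fun i hi => hasNthDeriv_costate_right hβ hy hT i hb (h i hi)).unique
    (HasNthDeriv.zero.congr hQ hb) hb (uniqueDiffOn_Icc hT.2)
  rw [← hr, left_eq_add]
  refine Finset.sum_eq_zero fun i hi => ?_
  have hlt : ¬ j ≤ (i : ℕ) := (Finset.mem_filter.1 hi).2
  obtain ⟨k, hk⟩ : ∃ k, j - (i : ℕ) = k + 1 := ⟨j - i - 1, by omega⟩
  rw [hk, Function.iterate_succ_apply', prim_self]

end NecessaryConditions

end FracVar

open FracVar in
theorem theorem3p1 {n : ℕ} (hn : 1 ≤ n) (a b : ℝ)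
    (α β : Fin n → ℝ → ℝ → ℝ) (hα : IsOrderFamily α a b) (hβ : IsOrderFamily β a b)
    (γ₁ γ₂ : Fin n → ℝ)
    (L : ℝ × ℝ × (Fin n → ℝ) → ℝ) (hL : ContDiffOn ℝ 1 L (Set.Icc a b ×ˢ Set.univ))
    (φ : ℝ × ℝ → ℝ) (hφ : ContDiffOn ℝ 1 φ (Set.Icc a b ×ˢ Set.univ))
    (xa : Fin n → ℝ) (x : ℝ → ℝ) (T : ℝ) (hT : T ∈ Set.Ioo a b)
    (hmin : IsLocalMinimizer α β γ₁ γ₂ a b L φ xa (x, T))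
    -- `y i` is the partial derivative of the Lagrangian, along `x`, at the place of the
    -- combined Caputo derivative with index `i`
    (y : Fin n → ℝ → ℝ)
    (hy : ∀ i t, y i t = partialVel L i (args α β γ₁ γ₂ a b x t)) :
    -- Euler-Lagrange equation on `[a,T]`
    (∀ t ∈ Set.Icc a T,
      (∀ i, γ₂ i ≠ 0 → LeftRLExists (i + 1) (β i) a b (y i) t) →
      (∀ i, γ₁ i ≠ 0 → RightRLExists (i + 1) (α i) a T (y i) t) →
      partialState L (args α β γ₁ γ₂ a b x t) +
        ∑ i : Fin n, (γ₂ i * leftRL (i + 1) (β i) a b (y i) t +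
          γ₁ i * rightRL (i + 1) (α i) a T (y i) t) = 0) ∧
    -- Euler-Lagrange equation on `[T,b]`
    (∀ t ∈ Set.Icc T b,
      (∀ i, γ₂ i ≠ 0 → LeftRLExists (i + 1) (β i) a b (y i) t ∧
        LeftRLExists (i + 1) (β i) T b (y i) t) →
      ∑ i : Fin n, γ₂ i * (leftRL (i + 1) (β i) a b (y i) t -
        leftRL (i + 1) (β i) T b (y i) t) = 0) ∧
    -- transversality condition for the terminal time
    (L (args α β γ₁ γ₂ a b x T) + deriv (fun s => φ (s, x T)) T +
      deriv (fun u => φ (T, u)) (x T) * derivWithin x (Set.Icc a b) T = 0) ∧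
    -- transversality condition at `T` for the terminal state
    ((∀ i : Fin n,
        (γ₁ i ≠ 0 → RightIntDerivExists i (i + 1) (α i) a T (y i) T) ∧
        (γ₂ i ≠ 0 → LeftIntDerivExists i (i + 1) (β i) a b (y i) T ∧
          LeftIntDerivExists i (i + 1) (β i) T b (y i) T)) →
      ∑ i : Fin n, (γ₁ i * (-1) ^ (i : ℕ) * rightIntDeriv i (i + 1) (α i) a T (y i) T -
          γ₂ i * leftIntDeriv i (i + 1) (β i) T b (y i) T) +
        deriv (fun u => φ (T, u)) (x T) = 0) ∧
    -- transversality conditions at `T` for the derivatives of order `j = 1, …, n-1`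
    (∀ j : ℕ, 1 ≤ j → j ≤ n - 1 →
      (∀ i : Fin n, j ≤ i →
        (γ₁ i ≠ 0 → RightIntDerivExists (i - j) (i + 1) (α i) a T (y i) T) ∧
        (γ₂ i ≠ 0 → LeftIntDerivExists (i - j) (i + 1) (β i) a b (y i) T ∧
          LeftIntDerivExists (i - j) (i + 1) (β i) T b (y i) T)) →
      ∑ i ∈ Finset.univ.filter (fun i : Fin n => j ≤ (i : ℕ)),
        (γ₁ i * (-1) ^ ((i : ℕ) - j) * rightIntDeriv (i - j) (i + 1) (α i) a T (y i) T +
          γ₂ i * (-1) ^ (j + 1) * leftIntDeriv (i - j) (i + 1) (β i) T b (y i) T) = 0) ∧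
    -- transversality conditions at `b` for `j = 0, …, n-1`
    (∀ j : ℕ, j ≤ n - 1 →
      (∀ i : Fin n, j ≤ i → γ₂ i ≠ 0 →
        LeftIntDerivExists (i - j) (i + 1) (β i) a b (y i) b ∧
        LeftIntDerivExists (i - j) (i + 1) (β i) T b (y i) b) →
      ∑ i ∈ Finset.univ.filter (fun i : Fin n => j ≤ (i : ℕ)), γ₂ i * (-1) ^ (j + 1) *
        (leftIntDeriv (i - j) (i + 1) (β i) a b (y i) b -
          leftIntDeriv (i - j) (i + 1) (β i) T b (y i) b) = 0) := by
  have hab : a < b := hT.1.trans hT.2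
  obtain ⟨⟨hx, hc, -⟩, -⟩ := hmin.1
  have hargs := continuousOn_args hx.continuousOn hc
  have hP : ContinuousOn (fun t => partialState L (args α β γ₁ γ₂ a b x t)) (Set.Icc a b) :=
    continuousOn_partialState_comp hab hL hargs fun t ht => ht
  have hyc : ∀ i, ContinuousOn (y i) (Set.Icc a b) := fun i =>
    (continuousOn_partialVel_comp hab hL i hargs fun t ht => ht).congr fun t _ => hy i t
  obtain ⟨hQl, hQr⟩ := primSum_eqOn (F := costate α β γ₁ γ₂ a b T
      (fun t => partialState L (args α β γ₁ γ₂ a b x t)) y)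
    (κ := deriv (fun u => φ (T, u)) (x T)) hn hT (continuousOn_costate hα hβ hP hyc hT) <| by
      intro g hg
      rw [← integral_first_variation hn hα hβ hP hyc hT hg]
      have hh0 : ∀ i : Fin n, iteratedDerivWithin i ((prim a)^[n] g) (Set.Icc a b) a = 0 := by
        intro i
        have h := iteratedDerivWithin_prim_iterate hab (Set.left_mem_Icc.2 hab.le)
          hg.continuousOn (Set.left_mem_Icc.2 hab.le) i (n - 1 - i + 1)
        rw [show (i : ℕ) + (n - 1 - i + 1) = n by omega] at h
        rw [h, Function.iterate_succ_apply', prim_self]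
      simpa only [hy] using hmin.first_variation hα hβ hL hφ hT
        (contDiff_prim_iterate a hg n).contDiffOn hh0
  refine ⟨?_, ?_, ?_, fun h => ?_, fun j hj hjn h => ?_, fun j hjn h => ?_⟩
  · intro t ht hA hR
    have h0 := euler_lagrange_left hn hα hβ hP hyc hT hQl ht hA hR
    exact h0
  · intro t ht hA
    exact euler_lagrange_right hα hβ hP hyc hT hQr ht hA
  · exact hmin.terminal_time hn hα hβ hL hφ hT
  · have h0 := transversality_at_T hα hβ hP hyc hT hQl hQr (Nat.zero_le _)
      fun i _ => by simpa only [Nat.sub_zero] using h i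
    have h1 : stepPrim T b 0 T = 1 := Set.indicator_of_mem Set.self_mem_Iic _
    rw [h1, mul_one] at h0
    simp only [Nat.zero_le, Finset.filter_true, Nat.sub_zero] at h0
    rw [← h0, ← Finset.sum_add_distrib]
    exact Finset.sum_eq_zero fun i _ => by ring
  · have h0 := transversality_at_T hα hβ hP hyc hT hQl hQr hjn h
    obtain ⟨k, rfl⟩ : ∃ k, j = k + 1 := ⟨j - 1, by omega⟩
    rw [stepPrim_succ_self hT.2.le, mul_zero] at h0
    rw [← mul_zero ((-1 : ℝ) ^ (k + 1 + 1)), ← h0, Finset.mul_sum]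
    refine Finset.sum_congr rfl fun i hi => ?_
    have hki : k + 1 ≤ (i : ℕ) := (Finset.mem_filter.1 hi).2
    -- `i - j` and `(j + 1) + (i + 1)` have the same parity
    have hpar : (-1 : ℝ) ^ (k + 1 + 1) * (-1) ^ ((i : ℕ) + 1) = (-1) ^ ((i : ℕ) - (k + 1)) := by
      rw [← pow_add, show k + 1 + 1 + ((i : ℕ) + 1) = (i - (k + 1)) + 2 * (k + 2) by omega, pow_add,
        pow_mul]
      simp
    rw [← hpar]
    ring
  · have h0 := transversality_at_b hα hβ hP hyc hT hQr hjn h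
    rw [← mul_zero ((-1 : ℝ) ^ (j + 1)), ← h0, Finset.mul_sum]
    exact Finset.sum_congr rfl fun i _ => by ring
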